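/- All graphs are finite and simple, and families of graphs are understood up to isomorphism. A set $S$ of vertices of a graph $G$ is a *disjunctive total dominating set* if every vertex of $G$ (in $S$ or not) is adjacent to a vertex of $S$ or has at least two vertices of $S$ at distance exactly $2$ from it; $\gamma_t^d(G)$ denotes the minimum cardinality of such a set. For $n_1,n_2\ge 3$ and $\ell\ge 0$, let $D_b(n_1,n_2,\ell)$ be the graph of order $n_1+n_2+\ell$ obtained by joining a vertex of a cycle $C_{n_1}$ to a vertex of a disjoint cycle $C_{n_2}$ by an edge and subdividing this edge $\ell$ times; write $D_b(n_1,n_2)=D_b(n_1,n_2,0)$. A *dumb-bell* is a graph of this form. Let $$\mathcal D_b=\{D_b(3,4),\,D_b(3,3,1),\,D_b(4,4),\,D_b(3,4,1),\,D_b(3,3,2),\,D_b(4,7,2),\,D_b(3,7,3),\,D_b(4,8,1),\,D_b(3,8,2),\,D_b(4,4,5),\,D_b(3,4,6),\,D_b(3,3,7)\}.$$ Consider the following graphs, each with a distinguished *link vertex* $v$: - $U_1$: a triangle, one of whose vertices is joined to $v$ by a path of length $2$; - $U_2$: a $4$-cycle, one of whose vertices is adjacent to $v$; - $X_1$: a $5$-cycle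 containing $v$; - $X_2$: a $6$-cycle, one of whose vertices is adjacent to $v$; - $X_3$ (respectively $X_4$): $v$ is adjacent to a vertex $a$, which is joined by a path of length $2$ to a vertex of a triangle and, in addition, is adjacent to a vertex of a second triangle (respectively lies on a $4$-cycle); - $X_5$ (respectively $X_6$): $v$ is adjacent to a vertex $a$, which is adjacent to a vertex of a $4$-cycle and, in addition, is adjacent to a vertex of a triangle (respectively lies on a second $4$-cycle). (Apart from the coincidences stated, all vertices are distinct.) Let $\mathcal G$ be the family of all graphs obtained from at least two disjoint graphs, at most one of which is one of $X_1,\dots,X_6$ and all the others of which are copies of $U_1$ or $U_2$, by identifying all their link vertices into one vertex, and let $\mathcal G_b$ be the family of all dumb-bells in $\mathcal G$. **Proposition.** If $G$ is a dumb-bell of order $n$, then $\gamma_t^d(G)\le n/2$; furthermore, $\gamma_t^d(G)\ge (n-1)/2$ if and only if $G\in\mathcal D_b\cup\mathcal G_b$. Here $\mathcal G_b$ consists of the seven dumb-bells $$D_b(3,3,3),\ D_b(3,4,2),\ D_b(4,4,1),\ D_b(3,5,1),\ D_b(4,5),\ D_b(3,6,2),\ D_b(4,6,1).$$ -/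

import Mathlib

namespace DTDom

/-- `S` is a disjunctive total dominating set of `G`: every vertex is adjacent to a vertex of `S`
or has at least two vertices of `S` at distance `2` from it. -/
def IsDTDSet {V : Type*} (G : SimpleGraph V) (S : Finset V) : Prop :=
  ∀ v : V, (∃ u ∈ S, G.Adj v u) ∨
    ∃ x ∈ S, ∃ y ∈ S, x ≠ y ∧ G.dist v x = 2 ∧ G.dist v y = 2

/-- The disjunctive total domination number: the minimum cardinality of a disjunctive total
dominating set. (A finite graph without isolated vertices has such a set, the whole vertex set.) -/
noncomputable def dtdNumber {V : Type*} (G : SimpleGraph V) : ℕ :=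
  sInf {k : ℕ | ∃ S : Finset V, IsDTDSet G S ∧ S.card = k}

/-- One orientation of each edge of the dumb-bell (both orientations inside the cycles and inside
the path): vertex `0` of a cycle on `n₁` vertices, the `l` path vertices in order, and vertex `0`
of a cycle on `n₂` vertices are joined consecutively. -/
def dumbbellRel (n₁ n₂ l : ℕ) :
    Fin n₁ ⊕ Fin l ⊕ Fin n₂ → Fin n₁ ⊕ Fin l ⊕ Fin n₂ → Prop
  | .inl i, .inl j => (SimpleGraph.cycleGraph n₁).Adj i j
  | .inr (.inl i), .inr (.inl j) => (SimpleGraph.pathGraph l).Adj i j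
  | .inr (.inr i), .inr (.inr j) => (SimpleGraph.cycleGraph n₂).Adj i j
  | .inl i, .inr (.inl j) => i.val = 0 ∧ j.val = 0
  | .inr (.inl i), .inr (.inr j) => i.val + 1 = l ∧ j.val = 0
  | .inl i, .inr (.inr j) => l = 0 ∧ i.val = 0 ∧ j.val = 0
  | _, _ => False

/-- The dumb-bell `D_b(n₁, n₂, l)`: an edge joining a vertex of `C_{n₁}` to a vertex of `C_{n₂}`,
subdivided `l` times. For `l = 0` this is `D_b(n₁, n₂)`. -/
def dumbbell (n₁ n₂ l : ℕ) : SimpleGraph (Fin n₁ ⊕ Fin l ⊕ Fin n₂) :=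
  SimpleGraph.fromRel (dumbbellRel n₁ n₂ l)

/-- `G` is a dumb-bell. -/
def IsDumbbell {V : Type*} (G : SimpleGraph V) : Prop :=
  ∃ n₁ n₂ l : ℕ, 3 ≤ n₁ ∧ 3 ≤ n₂ ∧ Nonempty (G ≃g dumbbell n₁ n₂ l)

/-- `G` is isomorphic to `D_b(n₁, n₂, l)` for some triple `(n₁, n₂, l)` in the list. -/
def IsDumbbellIn (L : List (ℕ × ℕ × ℕ)) {V : Type*} (G : SimpleGraph V) : Prop :=
  ∃ p ∈ L, Nonempty (G ≃g dumbbell p.1 p.2.1 p.2.2)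

/-- The family `𝓓_b` of twelve dumb-bells. -/
def MemDb {V : Type*} (G : SimpleGraph V) : Prop :=
  IsDumbbellIn
    [(3, 4, 0), (3, 3, 1), (4, 4, 0), (3, 4, 1), (3, 3, 2), (4, 7, 2),
     (3, 7, 3), (4, 8, 1), (3, 8, 2), (4, 4, 5), (3, 4, 6), (3, 3, 7)] G

/-- A graph with a distinguished link vertex, namely vertex `0`, and `size` further vertices
`1, …, size`. -/
structure LinkedGraph where
  /-- The number of vertices other than the link vertex. -/
  size : ℕ
  /-- The graph; its link vertex is `0`. -/
  graph : SimpleGraph (Fin (size + 1))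

/-- The linked graph on `0, …, m` with the edges listed. -/
def LinkedGraph.ofEdges (m : ℕ) (E : List (ℕ × ℕ)) : LinkedGraph where
  size := m
  graph := SimpleGraph.fromRel fun a b => (a.val, b.val) ∈ E

/-- The unit `U₁`: a triangle, one of whose vertices is joined to the link vertex by a path of
length `2`. -/
def U₁ : LinkedGraph := .ofEdges 4 [(0, 1), (1, 2), (2, 3), (3, 4), (4, 2)]

/-- The unit `U₂`: a 4-cycle, one of whose vertices is adjacent to the link vertex. -/
def U₂ : LinkedGraph := .ofEdges 4 [(0, 1), (1, 2), (2, 3), (3, 4), (4, 1)]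

/-- The unit `X₁`: a 5-cycle through the link vertex. -/
def X₁ : LinkedGraph := .ofEdges 4 [(0, 1), (1, 2), (2, 3), (3, 4), (4, 0)]

/-- The unit `X₂`: a 6-cycle, one of whose vertices is adjacent to the link vertex. -/
def X₂ : LinkedGraph :=
  .ofEdges 6 [(0, 1), (1, 2), (2, 3), (3, 4), (4, 5), (5, 6), (6, 1)]

/-- The unit `X₃`: the link vertex is adjacent to `1`, which is joined to a triangle `3, 4, 5` by
the path `1, 2, 3` and is adjacent to a vertex of a triangle `6, 7, 8`. -/
def X₃ : LinkedGraph :=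
  .ofEdges 8 [(0, 1), (1, 2), (2, 3), (3, 4), (4, 5), (5, 3), (1, 6), (6, 7), (7, 8), (8, 6)]

/-- The unit `X₄`: the link vertex is adjacent to `1`, which is joined to a triangle `3, 4, 5` by
the path `1, 2, 3` and lies on the 4-cycle `1, 6, 7, 8`. -/
def X₄ : LinkedGraph :=
  .ofEdges 8 [(0, 1), (1, 2), (2, 3), (3, 4), (4, 5), (5, 3), (1, 6), (6, 7), (7, 8), (8, 1)]

/-- The unit `X₅`: the link vertex is adjacent to `1`, which is adjacent to a vertex of a 4-cycle
`2, 3, 4, 5` and to a vertex of a triangle `6, 7, 8`. -/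
def X₅ : LinkedGraph :=
  .ofEdges 8 [(0, 1), (1, 2), (2, 3), (3, 4), (4, 5), (5, 2), (1, 6), (6, 7), (7, 8), (8, 6)]

/-- The unit `X₆`: the link vertex is adjacent to `1`, which is adjacent to a vertex of a 4-cycle
`2, 3, 4, 5` and lies on the 4-cycle `1, 6, 7, 8`. -/
def X₆ : LinkedGraph :=
  .ofEdges 8 [(0, 1), (1, 2), (2, 3), (3, 4), (4, 5), (5, 2), (1, 6), (6, 7), (7, 8), (8, 1)]

/-- The copy of the `i`-th linked graph inside the amalgam; `none` is the identified vertex. -/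
def linkCopy {ι : Type} (F : ι → LinkedGraph) (i : ι) :
    Fin ((F i).size + 1) → Option (Σ i, Fin (F i).size) :=
  Fin.cases none fun v => some ⟨i, v⟩

/-- The graph obtained from the disjoint union of the linked graphs `F i` by identifying all their
link vertices into one vertex. -/
def amalgam {ι : Type} (F : ι → LinkedGraph) : SimpleGraph (Option (Σ i, Fin (F i).size)) :=
  ⨆ i, (F i).graph.map (linkCopy F i)

/-- `G₀(n₁, n₂)`, made from `n₁` units `U₁` and `n₂` units `U₂`. -/
def unitGraph (n₁ n₂ : ℕ) :=
  amalgam (ι := Fin n₁ ⊕ Fin n₂) (Sum.elim (fun _ => U₁) (fun _ => U₂))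

/-- `G_i(n₁, n₂)` with `X = X_i`, made from `n₁` units `U₁`, `n₂` units `U₂` and one unit `X`. -/
def unitGraphWith (X : LinkedGraph) (n₁ n₂ : ℕ) :=
  amalgam (ι := (Fin n₁ ⊕ Fin n₂) ⊕ Fin 1)
    (Sum.elim (Sum.elim (fun _ => U₁) (fun _ => U₂)) (fun _ => X))

/-- The family `𝓖`, the union of the families `𝓖₀, 𝓖₁, …, 𝓖₆`. -/
def MemG {V : Type*} (G : SimpleGraph V) : Prop :=
  (∃ n₁ n₂ : ℕ, 2 ≤ n₁ + n₂ ∧ Nonempty (G ≃g unitGraph n₁ n₂)) ∨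
  ∃ X ∈ [X₁, X₂, X₃, X₄, X₅, X₆], ∃ n₁ n₂ : ℕ, 2 ≤ n₁ + n₂ + 1 ∧
    Nonempty (G ≃g unitGraphWith X n₁ n₂)

/-- The family `𝓖_b` of all dumb-bells in `𝓖`. -/
def MemGb {V : Type*} (G : SimpleGraph V) : Prop :=
  MemG G ∧ IsDumbbell G

end DTDom

/-! The inequality comes from a subdivision trick. Suppose an edge has both ends in a disjunctive
total dominating set `S`. Subdivide it by 4 or 5 new vertices and add the first and the last of
these to `S`: the result is again dominating (`IsChordDTDSet.insertSet`), and it still contains both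
ends of an edge in the same part of the graph, so the step can be repeated. The slack `n - 2|S|`
does not decrease with 4 new vertices and grows by at least 1 with 5.

Steps of 4 make the three lengths matter only modulo 4 once they are large. By symmetry `n₁ ≤ n₂`,
so only a finite box of triples remains. There each triple outside a list of 19 is reached from an
explicit seed with slack at least 2 (`all_covered`), which gives `γ ≤ (n - 2) / 2 < (n - 1) / 2` for
every dumb-bell not on the list.

The 19 listed dumb-bells have at most 13 vertices. Explicit sets give `γ ≤ n / 2`, and an
enumeration of all sets of size `⌊n / 2⌋ - 1` shows that none of them dominates
(`le_card_of_exceptional`). Hence `γ = ⌊n / 2⌋ ≥ (n - 1) / 2`.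

The 19 are the twelve members of `𝓓_b` and the seven of `𝓖_b`. For the latter (`memGb_iff`), a
dumb-bell has at most two vertices of degree at least 3 and none of degree 4. This rules out `X₃`,
…, `X₆` and leaves at most two units, since each unit contributes a vertex of degree at least 3; the
seven remaining amalgams are identified directly. -/

namespace DTDom

/-! ### Invariance under isomorphism -/

section Iso

variable {V W : Type*} {G : SimpleGraph V} {H : SimpleGraph W}

theorem dist_eq_two_iff {u v : V} :
    G.dist u v = 2 ↔ u ≠ v ∧ ¬ G.Adj u v ∧ ∃ w, G.Adj u w ∧ G.Adj w v := by
  have h : G.dist u v = 2 ↔ G.edist u v = 2 := by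
    rw [SimpleGraph.dist]
    constructor
    · intro h
      -- `dist` takes the value 0 on unconnected pairs, so the value 2 forces `edist` to be finite.
      have := ENat.natCast_toNat (n := G.edist u v) (by rintro h'; simp [h'] at h)
      rw [← this, h]; rfl
    · intro h; rw [h]; rfl
  rw [h, SimpleGraph.edist_eq_two_iff]
  simp only [Set.Nonempty, SimpleGraph.mem_commonNeighbors, G.adj_comm v]

theorem dist_eq_two_iso (e : G ≃g H) {u v : V} : H.dist (e u) (e v) = 2 ↔ G.dist u v = 2 := by
  simp only [dist_eq_two_iff, e.map_adj_iff, ne_eq, e.injective.eq_iff]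
  refine and_congr_right fun _ => and_congr_right fun _ => ?_
  constructor
  · rintro ⟨w, h₁, h₂⟩
    refine ⟨e.symm w, ?_, ?_⟩
    · rwa [← e.map_adj_iff, e.apply_symm_apply]
    · rwa [← e.map_adj_iff, e.apply_symm_apply]
  · rintro ⟨w, h₁, h₂⟩
    exact ⟨e w, e.map_adj_iff.2 h₁, e.map_adj_iff.2 h₂⟩

theorem IsDTDSet.map_iso (e : G ≃g H) {S : Finset V} (hS : IsDTDSet G S) :
    IsDTDSet H (S.map e.toEquiv.toEmbedding) := by
  intro v
  obtain ⟨v, rfl⟩ := e.surjective v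
  have hmem : ∀ {x}, x ∈ S → e x ∈ S.map e.toEquiv.toEmbedding := fun hx =>
    Finset.mem_map_of_mem _ hx
  rcases hS v with ⟨u, hu, h⟩ | ⟨x, hx, y, hy, hxy, h₁, h₂⟩
  · exact .inl ⟨e u, hmem hu, e.map_adj_iff.2 h⟩
  · exact .inr ⟨e x, hmem hx, e y, hmem hy, e.injective.ne hxy,
      (dist_eq_two_iso e).2 h₁, (dist_eq_two_iso e).2 h₂⟩

theorem dtdNumber_congr (e : G ≃g H) : dtdNumber G = dtdNumber H := by
  unfold dtdNumber
  congr 1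
  ext k
  constructor
  · rintro ⟨S, hS, rfl⟩
    exact ⟨_, hS.map_iso e, Finset.card_map _⟩
  · rintro ⟨S, hS, rfl⟩
    exact ⟨_, hS.map_iso e.symm, Finset.card_map _⟩

theorem dtdNumber_le {S : Finset V} (hS : IsDTDSet G S) : dtdNumber G ≤ S.card :=
  Nat.sInf_le ⟨S, hS, rfl⟩

end Iso

/-! ### Dumb-bells as paths with two chords -/

/-- Adjacency in the path `0, 1, …, N - 1` with the two chords `{0, a}` and `{b, N - 1}`. -/
def chordAdj (N a b x y : ℕ) : Prop :=
  x < N ∧ y < N ∧ (x + 1 = y ∨ y + 1 = x ∨ x = 0 ∧ y = a ∨ y = 0 ∧ x = a ∨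
    x = b ∧ y + 1 = N ∨ y = b ∧ x + 1 = N)

instance (N a b x y : ℕ) : Decidable (chordAdj N a b x y) := by
  unfold chordAdj; infer_instance

/-- The vertices `x` and `y` are at distance `2` in the path with two chords. -/
def chordDistTwo (N a b x y : ℕ) : Prop :=
  x ≠ y ∧ ¬ chordAdj N a b x y ∧ ∃ w, chordAdj N a b x w ∧ chordAdj N a b w y

/-- `S` is a disjunctive total dominating set of the path with two chords. -/
def IsChordDTDSet (N a b : ℕ) (S : Finset ℕ) : Prop :=
  (∀ x ∈ S, x < N) ∧ ∀ v < N, (∃ u ∈ S, chordAdj N a b v u) ∨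
    ∃ x ∈ S, ∃ y ∈ S, x ≠ y ∧ chordDistTwo N a b v x ∧ chordDistTwo N a b v y

/-- The position of a vertex of a dumb-bell on the Hamiltonian path that goes around the first
cycle to its attachment vertex, along the path, and around the second cycle. -/
def position (n₁ n₂ l : ℕ) : Fin n₁ ⊕ Fin l ⊕ Fin n₂ → ℕ
  | .inl i => n₁ - 1 - i.val
  | .inr (.inl i) => n₁ + i.val
  | .inr (.inr i) => n₁ + l + i.val

theorem position_lt {n₁ n₂ l : ℕ} (x : Fin n₁ ⊕ Fin l ⊕ Fin n₂) :
    position n₁ n₂ l x < n₁ + n₂ + l := by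
  rcases x with i | i | i <;> simp only [position] <;> omega

theorem position_injective (n₁ n₂ l : ℕ) : Function.Injective (position n₁ n₂ l) := by
  rintro (i | i | i) (j | j | j) h <;> simp only [position] at h
  · have : i = j := by ext; omega
    rw [this]
  · omega
  · omega
  · omega
  · have : i = j := by ext; omega
    rw [this]
  · omega
  · omega
  · omega
  · have : i = j := by ext; omega
    rw [this]

theorem exists_position_eq {n₁ n₂ l k : ℕ} (hk : k < n₁ + n₂ + l) :
    ∃ x, position n₁ n₂ l x = k := by
  by_cases h₁ : k < n₁
  · exact ⟨.inl ⟨n₁ - 1 - k, by omega⟩, by simp only [position]; omega⟩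
  by_cases h₂ : k < n₁ + l
  · exact ⟨.inr (.inl ⟨k - n₁, by omega⟩), by simp only [position]; omega⟩
  · exact ⟨.inr (.inr ⟨k - n₁ - l, by omega⟩), by simp only [position]; omega⟩

theorem cycleGraph_adj_iff {n : ℕ} (hn : 3 ≤ n) (i j : Fin n) :
    (SimpleGraph.cycleGraph n).Adj i j ↔ i.val + 1 = j.val ∨ j.val + 1 = i.val ∨
      i.val = 0 ∧ j.val + 1 = n ∨ j.val = 0 ∧ i.val + 1 = n := by
  rw [SimpleGraph.cycleGraph_adj']
  have key : ∀ i j : Fin n, (i - j).val = 1 ↔ j.val + 1 = i.val ∨ i.val = 0 ∧ j.val + 1 = n := by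
    intro i j
    rcases le_or_gt j i with h | h
    · rw [Fin.sub_val_of_le h]
      have := Fin.le_def.1 h
      omega
    · have := Fin.lt_def.1 h
      rw [Fin.val_sub, Nat.mod_eq_of_lt (by omega)]
      omega
  rw [key, key]
  tauto

/-- The first cycle is numbered backwards, so its attachment vertex gets position `n₁ - 1`, next to
the path. All edges then join consecutive numbers, except the closing edge of each cycle. This turns
every question on dumb-bells into arithmetic. -/
theorem dumbbell_adj_iff {n₁ n₂ l : ℕ} (h₁ : 3 ≤ n₁) (h₂ : 3 ≤ n₂)
    (x y : Fin n₁ ⊕ Fin l ⊕ Fin n₂) :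
    (dumbbell n₁ n₂ l).Adj x y ↔ chordAdj (n₁ + n₂ + l) (n₁ - 1) (n₁ + l)
      (position n₁ n₂ l x) (position n₁ n₂ l y) := by
  unfold dumbbell chordAdj
  rw [SimpleGraph.fromRel_adj, ← (position_injective n₁ n₂ l).ne_iff]
  have hx := position_lt x
  have hy := position_lt y
  rcases x with i | i | i <;> rcases y with j | j | j <;>
    simp only [dumbbellRel, position, cycleGraph_adj_iff h₁, cycleGraph_adj_iff h₂,
      SimpleGraph.pathGraph_adj, or_false, false_or] at hx hy ⊢ <;> omega

theorem dumbbell_dist_eq_two_iff {n₁ n₂ l : ℕ} (h₁ : 3 ≤ n₁) (h₂ : 3 ≤ n₂)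
    (x y : Fin n₁ ⊕ Fin l ⊕ Fin n₂) :
    (dumbbell n₁ n₂ l).dist x y = 2 ↔ chordDistTwo (n₁ + n₂ + l) (n₁ - 1) (n₁ + l)
      (position n₁ n₂ l x) (position n₁ n₂ l y) := by
  simp only [dist_eq_two_iff, chordDistTwo, dumbbell_adj_iff h₁ h₂,
    (position_injective n₁ n₂ l).ne_iff]
  refine and_congr_right fun _ => and_congr_right fun _ => ?_
  constructor
  · rintro ⟨w, h⟩
    exact ⟨_, h⟩
  · rintro ⟨w, h⟩
    obtain ⟨w, rfl⟩ := exists_position_eq h.1.2.1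
    exact ⟨w, h⟩

theorem IsDTDSet.image_position {n₁ n₂ l : ℕ} (h₁ : 3 ≤ n₁) (h₂ : 3 ≤ n₂)
    {S : Finset (Fin n₁ ⊕ Fin l ⊕ Fin n₂)} (hS : IsDTDSet (dumbbell n₁ n₂ l) S) :
    IsChordDTDSet (n₁ + n₂ + l) (n₁ - 1) (n₁ + l) (S.image (position n₁ n₂ l)) := by
  constructor
  · intro x hx
    obtain ⟨y, -, rfl⟩ := Finset.mem_image.1 hx
    exact position_lt y
  · intro v hv
    obtain ⟨v, rfl⟩ := exists_position_eq hv
    rcases hS v with ⟨u, hu, h⟩ | ⟨x, hx, y, hy, hxy, h, h'⟩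
    · exact .inl ⟨_, Finset.mem_image_of_mem _ hu, (dumbbell_adj_iff h₁ h₂ _ _).1 h⟩
    · exact .inr ⟨_, Finset.mem_image_of_mem _ hx, _, Finset.mem_image_of_mem _ hy,
        (position_injective n₁ n₂ l).ne hxy, (dumbbell_dist_eq_two_iff h₁ h₂ _ _).1 h,
        (dumbbell_dist_eq_two_iff h₁ h₂ _ _).1 h'⟩

theorem IsChordDTDSet.isDTDSet {n₁ n₂ l : ℕ} (h₁ : 3 ≤ n₁) (h₂ : 3 ≤ n₂) {S : Finset ℕ}
    (hS : IsChordDTDSet (n₁ + n₂ + l) (n₁ - 1) (n₁ + l) S) :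
    IsDTDSet (dumbbell n₁ n₂ l) {x | position n₁ n₂ l x ∈ S} := by
  intro v
  rcases hS.2 _ (position_lt v) with ⟨u, hu, h⟩ | ⟨x, hx, y, hy, hxy, h, h'⟩
  · obtain ⟨u, rfl⟩ := exists_position_eq (hS.1 u hu)
    exact .inl ⟨u, by simpa using hu, (dumbbell_adj_iff h₁ h₂ _ _).2 h⟩
  · obtain ⟨x, rfl⟩ := exists_position_eq (hS.1 x hx)
    obtain ⟨y, rfl⟩ := exists_position_eq (hS.1 y hy)
    exact .inr ⟨x, by simpa using hx, y, by simpa using hy, fun h => hxy (by rw [h]),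
      (dumbbell_dist_eq_two_iff h₁ h₂ _ _).2 h, (dumbbell_dist_eq_two_iff h₁ h₂ _ _).2 h'⟩

theorem dtdNumber_dumbbell_le {n₁ n₂ l : ℕ} (h₁ : 3 ≤ n₁) (h₂ : 3 ≤ n₂) {S : Finset ℕ}
    (hS : IsChordDTDSet (n₁ + n₂ + l) (n₁ - 1) (n₁ + l) S) :
    dtdNumber (dumbbell n₁ n₂ l) ≤ S.card := by
  refine (dtdNumber_le (hS.isDTDSet h₁ h₂)).trans ?_
  refine Finset.card_le_card_of_injOn (position n₁ n₂ l) ?_ (position_injective _ _ _).injOn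
  intro x hx
  simpa using hx

/-- If there is a disjunctive total dominating set at all, then there is one whose size is the
disjunctive total domination number. -/
theorem exists_chordDTDSet_card_eq {n₁ n₂ l : ℕ} (h₁ : 3 ≤ n₁) (h₂ : 3 ≤ n₂) {S : Finset ℕ}
    (hS : IsChordDTDSet (n₁ + n₂ + l) (n₁ - 1) (n₁ + l) S) :
    ∃ T, IsChordDTDSet (n₁ + n₂ + l) (n₁ - 1) (n₁ + l) T ∧
      T.card = dtdNumber (dumbbell n₁ n₂ l) := by
  -- The infimum of the empty set would be 0; the set `S` rules this out.
  obtain ⟨T, hT, hc⟩ := Nat.sInf_mem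
    (s := {k | ∃ S, IsDTDSet (dumbbell n₁ n₂ l) S ∧ S.card = k}) ⟨_, _, hS.isDTDSet h₁ h₂, rfl⟩
  exact ⟨_, hT.image_position h₁ h₂,
    (Finset.card_image_of_injective _ (position_injective _ _ _)).trans hc⟩

/-- The two cycles of a dumb-bell can be exchanged. -/
theorem dumbbell_swap (n₁ n₂ l : ℕ) : Nonempty (dumbbell n₁ n₂ l ≃g dumbbell n₂ n₁ l) := by
  refine ⟨⟨⟨fun x => match x with
      | .inl i => .inr (.inr i)
      | .inr (.inl i) => .inr (.inl i.rev)
      | .inr (.inr i) => .inl i, fun x => match x with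
      | .inl i => .inr (.inr i)
      | .inr (.inl i) => .inr (.inl i.rev)
      | .inr (.inr i) => .inl i, ?_, ?_⟩, ?_⟩⟩
  · rintro (i | i | i) <;> simp
  · rintro (i | i | i) <;> simp
  · rintro (i | i | i) (j | j | j) <;>
      simp [dumbbell, dumbbellRel, SimpleGraph.pathGraph_adj, Fin.ext_iff] <;> omega

/-! ### Subdividing an edge between two vertices of a dominating set -/

/-- The relabelling of the vertices when `c` vertices are inserted after the vertex `i`. -/
def shift (c i x : ℕ) : ℕ := if x ≤ i then x else x + c

theorem shift_injective (c i : ℕ) : Function.Injective (shift c i) := by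
  intro x y h
  unfold shift at h
  split_ifs at h <;> omega

/-- Subdividing `{i, i + 1}` destroys this edge alone; every other pair keeps its status. -/
theorem chordAdj_shift {N a b c i x y : ℕ} (hi : i + 1 < N)
    (hxy : ¬ (x = i ∧ y = i + 1)) (hyx : ¬ (y = i ∧ x = i + 1)) :
    chordAdj (N + c) (shift c i a) (shift c i b) (shift c i x) (shift c i y) ↔
      chordAdj N a b x y := by
  have lt_iff : ∀ z, shift c i z < N + c ↔ z < N := by
    intro z; unfold shift; split_ifs <;> omega
  have last_iff : ∀ z, shift c i z + 1 = N + c ↔ z + 1 = N := by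
    intro z; unfold shift; split_ifs <;> omega
  have zero_iff : ∀ z, shift c i z = 0 ↔ z = 0 := by
    intro z; unfold shift; split_ifs <;> omega
  have succ_iff : ∀ z w, ¬ (z = i ∧ w = i + 1) →
      (shift c i z + 1 = shift c i w ↔ z + 1 = w) := by
    intro z w h; unfold shift; split_ifs <;> omega
  unfold chordAdj
  simp only [lt_iff, last_iff, zero_iff, succ_iff x y hxy, succ_iff y x hyx,
    (shift_injective c i).eq_iff]

/-- The set obtained by inserting `c` vertices after the vertex `i`, the first and the last of
which belong to the set. -/
def insertSet (c i : ℕ) (S : Finset ℕ) : Finset ℕ :=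
  insert (i + 1) (insert (i + c) (S.image (shift c i)))

theorem card_insertSet_le (c i : ℕ) (S : Finset ℕ) : (insertSet c i S).card ≤ S.card + 2 := by
  refine (Finset.card_insert_le _ _).trans ?_
  have := Finset.card_insert_le (i + c) (S.image (shift c i))
  have := Finset.card_image_le (s := S) (f := shift c i)
  omega

theorem shift_mem_insertSet {c i x : ℕ} {S : Finset ℕ} (hx : x ∈ S) :
    shift c i x ∈ insertSet c i S := by
  simp only [insertSet, Finset.mem_insert, Finset.mem_image]
  exact .inr (.inr ⟨x, hx, rfl⟩)

theorem chordDistTwo_shift {N a b c i v x w : ℕ} (hi : i + 1 < N) (hv : v ≠ i)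
    (hv' : v ≠ i + 1) (hwi : w ≠ i) (hwi' : w ≠ i + 1) (hne : v ≠ x)
    (hn : ¬ chordAdj N a b v x) (h₁ : chordAdj N a b v w) (h₂ : chordAdj N a b w x) :
    chordDistTwo (N + c) (shift c i a) (shift c i b) (shift c i v) (shift c i x) := by
  refine ⟨(shift_injective c i).ne hne, ?_, shift c i w, ?_, ?_⟩
  · rwa [chordAdj_shift hi (by omega) (by omega)]
  · rwa [chordAdj_shift hi (by omega) (by omega)]
  · rwa [chordAdj_shift hi (by omega) (by omega)]

/-- The chosen vertices are now `i, i + 1` and `i + c, i + c + 1`, which are adjacent in pairs and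
leave only `c - 2` new vertices between them. An old vertex could lose its domination only through
the destroyed edge, and both ends of that edge lie in `S`. -/
theorem IsChordDTDSet.insertSet {N a b c i : ℕ} {S : Finset ℕ} (hS : IsChordDTDSet N a b S)
    (hc : c = 4 ∨ c = 5) (hi : i + 1 < N)
    (his : i ∈ S) (his' : i + 1 ∈ S) :
    IsChordDTDSet (N + c) (shift c i a) (shift c i b) (insertSet c i S) := by
  have hl : i + 1 ∈ DTDom.insertSet c i S := by simp [DTDom.insertSet]
  have hr : i + c ∈ DTDom.insertSet c i S := by simp [DTDom.insertSet]
  have hl' : i ∈ DTDom.insertSet c i S := by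
    simpa [shift] using shift_mem_insertSet (c := c) (i := i) his
  have hr' : i + 1 + c ∈ DTDom.insertSet c i S := by
    simpa [shift] using shift_mem_insertSet (c := c) (i := i) his'
  constructor
  · intro x hx
    simp only [DTDom.insertSet, Finset.mem_insert, Finset.mem_image] at hx
    rcases hx with rfl | rfl | ⟨y, hy, rfl⟩
    · omega
    · omega
    · have := hS.1 y hy
      unfold shift
      split_ifs <;> omega
  intro v hv
  have path_adj : ∀ x y, x < N + c → y < N + c → (x + 1 = y ∨ y + 1 = x) →
      chordAdj (N + c) (shift c i a) (shift c i b) x y := by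
    intro x y hx hy h
    unfold chordAdj
    tauto
  by_cases h0 : v = i
  · exact .inl ⟨i + 1, hl, path_adj _ _ (by omega) (by omega) (by omega)⟩
  by_cases h1 : v = i + 1
  · exact .inl ⟨i, hl', path_adj _ _ (by omega) (by omega) (by omega)⟩
  by_cases h2 : v = i + 2
  · exact .inl ⟨i + 1, hl, path_adj _ _ (by omega) (by omega) (by omega)⟩
  by_cases h3 : v + 1 = i + c
  · exact .inl ⟨i + c, hr, path_adj _ _ (by omega) (by omega) (by omega)⟩
  by_cases h4 : v = i + c
  · exact .inl ⟨i + 1 + c, hr', path_adj _ _ (by omega) (by omega) (by omega)⟩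
  by_cases h5 : v = i + 1 + c
  · exact .inl ⟨i + c, hr, path_adj _ _ (by omega) (by omega) (by omega)⟩
  -- For `c = 5` the middle new vertex has no chosen neighbour on the path, but `i + 1` and `i + 5`
  -- are at distance 2 from it.
  by_cases h6 : v = i + 3 ∧ c = 5
  · obtain ⟨rfl, rfl⟩ := h6
    refine .inr ⟨i + 1, hl, i + 5, hr, by omega, ⟨by omega, ?_, i + 2, ?_, ?_⟩,
      ⟨by omega, ?_, i + 4, ?_, ?_⟩⟩
    · unfold chordAdj shift
      split_ifs <;> omega
    · exact path_adj _ _ (by omega) (by omega) (by omega)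
    · exact path_adj _ _ (by omega) (by omega) (by omega)
    · unfold chordAdj shift
      split_ifs <;> omega
    · exact path_adj _ _ (by omega) (by omega) (by omega)
    · exact path_adj _ _ (by omega) (by omega) (by omega)
  obtain ⟨u, hu, rfl⟩ : ∃ u < N, shift c i u = v := by
    by_cases h : v ≤ i
    · exact ⟨v, by omega, by simp [shift, h]⟩
    · refine ⟨v - c, by omega, ?_⟩
      unfold shift
      split_ifs <;> omega
  have hui : u ≠ i := by
    rintro rfl
    simp [shift] at h0
  have hui' : u ≠ i + 1 := by
    rintro rfl
    simp [shift] at h5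
  have adj_mem : ∀ w ∈ S, chordAdj N a b u w →
      ∃ w ∈ DTDom.insertSet c i S,
        chordAdj (N + c) (shift c i a) (shift c i b) (shift c i u) w := by
    intro w hw h
    exact ⟨_, shift_mem_insertSet hw,
      (chordAdj_shift hi (by omega) (by omega)).2 h⟩
  rcases hS.2 u hu with ⟨w, hw, h⟩ |
    ⟨x, hx, y, hy, hxy, ⟨hne, hn, w, h, h'⟩, ⟨hne₂, hn₂, w₂, k, k₂⟩⟩
  · exact .inl (adj_mem w hw h)
  -- If the middle vertex of a path of length 2 is in `S`, it dominates `u` by adjacency. Otherwise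
  -- it is neither `i` nor `i + 1`, and both edges of the path survive.
  · by_cases hw : w ∈ S
    · exact .inl (adj_mem w hw h)
    by_cases hw₂ : w₂ ∈ S
    · exact .inl (adj_mem w₂ hw₂ k)
    have hmem : ∀ {z}, z ∉ S → z ≠ i ∧ z ≠ i + 1 := fun hz =>
      ⟨fun h => hz (h ▸ his), fun h => hz (h ▸ his')⟩
    exact .inr ⟨_, shift_mem_insertSet hx, _, shift_mem_insertSet hy, (shift_injective c i).ne hxy,
      chordDistTwo_shift hi hui hui' (hmem hw).1 (hmem hw).2 hne hn h h',
      chordDistTwo_shift hi hui hui' (hmem hw₂).1 (hmem hw₂).2 hne₂ hn₂ k k₂⟩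

/-! ### Repeated subdivision and the slack `n - 2|S|` -/

/-- Some edge `{i, i + 1}` with `p ≤ i < q` has both ends in `S`. -/
def HasEdge (S : Finset ℕ) (p q : ℕ) : Prop :=
  ∃ i, p ≤ i ∧ i < q ∧ i ∈ S ∧ i + 1 ∈ S

/-- This allows subdivision to be iterated: if the edge in question is the subdivided one, then `{i,
i + 1}`, with `i + 1` now new, takes its place. -/
theorem HasEdge.insertSet {S : Finset ℕ} {p q i : ℕ} (c : ℕ) (hc : 1 ≤ c) (h : HasEdge S p q)
    (his : i ∈ S) : HasEdge (insertSet c i S) (shift c i p) (shift c i q) := by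
  obtain ⟨j, hp, hq, hj, hj₁⟩ := h
  by_cases hji : j = i
  · subst hji
    refine ⟨j, ?_, ?_, ?_, by simp [DTDom.insertSet]⟩
    · unfold shift; split_ifs; omega
    · unfold shift; split_ifs <;> omega
    · simpa [shift] using shift_mem_insertSet (c := c) (i := j) his
  · refine ⟨shift c i j, ?_, ?_, shift_mem_insertSet hj, ?_⟩
    · unfold shift; split_ifs <;> omega
    · unfold shift; split_ifs <;> omega
    · have : shift c i j + 1 = shift c i (j + 1) := by
        unfold shift; split_ifs <;> omega
      rw [this]
      exact shift_mem_insertSet hj₁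

/-- The dumb-bell has a disjunctive total dominating set of size at most `(n - s) / 2`, which
contains both ends of an edge of the first cycle, of the second cycle or of the path,
as far as `m₁`, `m₂` and `m₃` say so. -/
def HasSlackSet (n₁ n₂ l s : ℕ) (m₁ m₂ m₃ : Bool) : Prop :=
  ∃ S, IsChordDTDSet (n₁ + n₂ + l) (n₁ - 1) (n₁ + l) S ∧ 2 * S.card + s ≤ n₁ + n₂ + l ∧
    (m₁ = true → HasEdge S 0 (n₁ - 1)) ∧ (m₂ = true → HasEdge S (n₁ + l) (n₁ + n₂ + l - 1)) ∧
    (m₃ = true → HasEdge S (n₁ - 1) (n₁ + l))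

section

variable {n₁ n₂ l s : ℕ} {m₁ m₂ m₃ : Bool}

/-- Inserting `c` vertices into the dumb-bell, on the edge `{i, i + 1}`. -/
theorem HasSlackSet.insert_aux {n₁' n₂' l' c i : ℕ} {S : Finset ℕ} (h₁ : 3 ≤ n₁) (h₂ : 3 ≤ n₂)
    (hc : c = 4 ∨ c = 5) (hN : n₁' + n₂' + l' = n₁ + n₂ + l + c)
    (hi : i + 1 < n₁ + n₂ + l) (ha : n₁' - 1 = shift c i (n₁ - 1))
    (hb : n₁' + l' = shift c i (n₁ + l))
    (hS : IsChordDTDSet (n₁ + n₂ + l) (n₁ - 1) (n₁ + l) S) (hs : 2 * S.card + s ≤ n₁ + n₂ + l)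
    (hm₁ : m₁ = true → HasEdge S 0 (n₁ - 1))
    (hm₂ : m₂ = true → HasEdge S (n₁ + l) (n₁ + n₂ + l - 1))
    (hm₃ : m₃ = true → HasEdge S (n₁ - 1) (n₁ + l)) (his : i ∈ S) (his' : i + 1 ∈ S) :
    HasSlackSet n₁' n₂' l' (s + c - 4) m₁ m₂ m₃ := by
  have hN' : n₁' + n₂' + l' - 1 = shift c i (n₁ + n₂ + l - 1) := by
    unfold shift; split_ifs <;> omega
  have h0 : 0 = shift c i 0 := by simp [shift]
  refine ⟨DTDom.insertSet c i S, ?_, ?_, ?_, ?_, ?_⟩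
  · rw [hN, ha, hb]
    exact hS.insertSet hc hi his his'
  -- The order grows by `c` and the set by at most 2, so the slack gains at least `c - 4`.
  · have := card_insertSet_le c i S
    omega
  · intro h
    rw [ha, h0]
    exact (hm₁ h).insertSet c (by omega) his
  · intro h
    rw [hb, hN']
    exact (hm₂ h).insertSet c (by omega) his
  · intro h
    rw [ha, hb]
    exact (hm₃ h).insertSet c (by omega) his

theorem HasSlackSet.insert_fst (h₁ : 3 ≤ n₁) (h₂ : 3 ≤ n₂) {c : ℕ} (hc : c = 4 ∨ c = 5)
    (h : HasSlackSet n₁ n₂ l s true m₂ m₃) :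
    HasSlackSet (n₁ + c) n₂ l (s + c - 4) true m₂ m₃ := by
  obtain ⟨S, hS, hs, hm₁, hm₂, hm₃⟩ := h
  obtain ⟨i, hp, hq, his, his'⟩ := hm₁ rfl
  refine HasSlackSet.insert_aux h₁ h₂ hc (i := i) ?_ ?_ ?_ ?_ hS hs hm₁ hm₂ hm₃ his his' <;>
    first | omega | (unfold shift; split_ifs <;> omega)

theorem HasSlackSet.insert_snd (h₁ : 3 ≤ n₁) (h₂ : 3 ≤ n₂) {c : ℕ} (hc : c = 4 ∨ c = 5)
    (h : HasSlackSet n₁ n₂ l s m₁ true m₃) :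
    HasSlackSet n₁ (n₂ + c) l (s + c - 4) m₁ true m₃ := by
  obtain ⟨S, hS, hs, hm₁, hm₂, hm₃⟩ := h
  obtain ⟨i, hp, hq, his, his'⟩ := hm₂ rfl
  refine HasSlackSet.insert_aux h₁ h₂ hc (i := i) ?_ ?_ ?_ ?_ hS hs hm₁ hm₂ hm₃ his his' <;>
    first | omega | (unfold shift; split_ifs <;> omega)

theorem HasSlackSet.insert_path (h₁ : 3 ≤ n₁) (h₂ : 3 ≤ n₂) {c : ℕ} (hc : c = 4 ∨ c = 5)
    (h : HasSlackSet n₁ n₂ l s m₁ m₂ true) :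
    HasSlackSet n₁ n₂ (l + c) (s + c - 4) m₁ m₂ true := by
  obtain ⟨S, hS, hs, hm₁, hm₂, hm₃⟩ := h
  obtain ⟨i, hp, hq, his, his'⟩ := hm₃ rfl
  refine HasSlackSet.insert_aux h₁ h₂ hc (i := i) ?_ ?_ ?_ ?_ hS hs hm₁ hm₂ hm₃ his his' <;>
    first | omega | (unfold shift; split_ifs <;> omega)

/-- If a property of a size and a slack is stable under increasing the size by `4`, and under
increasing the size by `5` and the slack by `1`, then it is stable under increasing the size by any
`d = 4 i + 5 (d % 4)` and the slack by `d % 4`. -/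
theorem grow {P : ℕ → ℕ → Prop} {x : ℕ} (h4 : ∀ n s, x ≤ n → P n s → P (n + 4) s)
    (h5 : ∀ n s, x ≤ n → P n s → P (n + 5) (s + 1)) {s d : ℕ} (hd : 5 * (d % 4) ≤ d)
    (h : P x s) : P (x + d) (s + d % 4) := by
  have fives : ∀ j, P (x + 5 * j) (s + j) := by
    intro j
    induction j with
    | zero => simpa using h
    | succ j ih => exact h5 _ _ (Nat.le_add_right _ _) ih
  have fours : ∀ i, P (x + 5 * (d % 4) + 4 * i) (s + d % 4) := by
    intro i
    induction i with
    | zero => exact fives _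
    | succ i ih => exact h4 (x + 5 * (d % 4) + 4 * i) _ (by omega) ih
  -- Since `5 * (d % 4)` is congruent to `d` modulo 4, the division is exact.
  have := fours ((d - 5 * (d % 4)) / 4)
  rwa [show x + 5 * (d % 4) + 4 * ((d - 5 * (d % 4)) / 4) = x + d by omega] at this

theorem HasSlackSet.grow_fst (h₁ : 3 ≤ n₁) (h₂ : 3 ≤ n₂) {d : ℕ} (hd : 5 * (d % 4) ≤ d)
    (hm : d = 0 ∨ m₁ = true) (h : HasSlackSet n₁ n₂ l s m₁ m₂ m₃) :
    HasSlackSet (n₁ + d) n₂ l (s + d % 4) m₁ m₂ m₃ := by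
  rcases hm with rfl | rfl
  · exact h
  · exact grow (P := fun n s => HasSlackSet n n₂ l s true m₂ m₃)
      (fun n s hn h => h.insert_fst (by omega) h₂ (.inl rfl))
      (fun n s hn h => h.insert_fst (by omega) h₂ (.inr rfl)) hd h

theorem HasSlackSet.grow_snd (h₁ : 3 ≤ n₁) (h₂ : 3 ≤ n₂) {d : ℕ} (hd : 5 * (d % 4) ≤ d)
    (hm : d = 0 ∨ m₂ = true) (h : HasSlackSet n₁ n₂ l s m₁ m₂ m₃) :
    HasSlackSet n₁ (n₂ + d) l (s + d % 4) m₁ m₂ m₃ := by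
  rcases hm with rfl | rfl
  · exact h
  · exact grow (P := fun n s => HasSlackSet n₁ n l s m₁ true m₃)
      (fun n s hn h => h.insert_snd h₁ (by omega) (.inl rfl))
      (fun n s hn h => h.insert_snd h₁ (by omega) (.inr rfl)) hd h

theorem HasSlackSet.grow_path (h₁ : 3 ≤ n₁) (h₂ : 3 ≤ n₂) {d : ℕ} (hd : 5 * (d % 4) ≤ d)
    (hm : d = 0 ∨ m₃ = true) (h : HasSlackSet n₁ n₂ l s m₁ m₂ m₃) :
    HasSlackSet n₁ n₂ (l + d) (s + d % 4) m₁ m₂ m₃ := by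
  rcases hm with rfl | rfl
  · exact h
  · exact grow (P := fun n s => HasSlackSet n₁ n₂ n s m₁ m₂ true)
      (fun n s hn h => h.insert_path h₁ h₂ (.inl rfl))
      (fun n s hn h => h.insert_path h₁ h₂ (.inr rfl)) hd h

end

/-! ### Finitely many dumb-bells -/

/-- A list that contains the neighbours of `x`. -/
def neighborCandidates (N a b x : ℕ) : List ℕ := [x + 1, x - 1, 0, a, b, N - 1]

/-- The middle vertex ranges over a list of six candidates instead of all of `ℕ`. Superfluous
candidates, such as the truncated `x - 1` at `x = 0`, do no harm because adjacency is tested anyway.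
-/
instance (N a b x y : ℕ) : Decidable (chordDistTwo N a b x y) :=
  decidable_of_iff (x ≠ y ∧ ¬ chordAdj N a b x y ∧
    ∃ w ∈ neighborCandidates N a b x, chordAdj N a b x w ∧ chordAdj N a b w y) <| by
  unfold chordDistTwo neighborCandidates
  refine and_congr_right fun _ => and_congr_right fun _ => ?_
  constructor
  · rintro ⟨w, -, h⟩
    exact ⟨w, h⟩
  · rintro ⟨w, h⟩
    refine ⟨w, ?_, h⟩
    have := h.1
    unfold chordAdj at this
    simp only [List.mem_cons, List.not_mem_nil, or_false]
    omega

/-- `IsChordDTDSet` for a set given as a list, in a form that is fast to decide. -/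
def IsChordDTDList (N a b : ℕ) (T : List ℕ) : Prop :=
  (∀ x ∈ T, x < N) ∧ ∀ v < N, (∃ u ∈ T, chordAdj N a b v u) ∨
    ∃ x ∈ T, chordDistTwo N a b v x ∧ ∃ y ∈ T, x ≠ y ∧ chordDistTwo N a b v y

instance (N a b : ℕ) (T : List ℕ) : Decidable (IsChordDTDList N a b T) := by
  unfold IsChordDTDList; infer_instance

theorem isChordDTDSet_toFinset {N a b : ℕ} {T : List ℕ} :
    IsChordDTDSet N a b T.toFinset ↔ IsChordDTDList N a b T := by
  unfold IsChordDTDSet IsChordDTDList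
  simp only [List.mem_toFinset]
  refine and_congr_right fun _ => forall₂_congr fun v _ => or_congr_right ?_
  constructor
  · rintro ⟨x, hx, y, hy, h, h₁, h₂⟩
    exact ⟨x, hx, h₁, y, hy, h, h₂⟩
  · rintro ⟨x, hx, h₁, y, hy, h, h₂⟩
    exact ⟨x, hx, y, hy, h, h₁, h₂⟩

/-- Disjunctive total dominating sets of some dumb-bells. In the entry `(n₁, n₂, l, T)`, the list
`T` consists of positions of vertices of `D_b(n₁, n₂, l)`. -/
def seeds : List (ℕ × ℕ × ℕ × List ℕ) := [
    (3, 3, 0, [2, 3]), (3, 4, 0, [2, 3, 4]), (3, 5, 0, [2, 3, 4]), (3, 6, 0, [2, 4, 8]),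
    (3, 7, 0, [1, 2, 6, 7]), (3, 8, 0, [2, 3, 6, 7]), (4, 5, 0, [2, 3, 4, 5]),
    (4, 6, 0, [0, 3, 6, 7]), (4, 7, 0, [2, 3, 7, 8]), (4, 8, 0, [2, 3, 4, 7, 8]),
    (4, 9, 0, [2, 3, 4, 8, 9]), (5, 5, 0, [3, 4, 5, 6]), (5, 6, 0, [0, 4, 7, 8]),
    (5, 7, 0, [3, 4, 5, 7, 8]), (5, 8, 0, [0, 4, 5, 8, 9]), (6, 6, 0, [1, 2, 6, 7, 8]),
    (6, 7, 0, [0, 1, 5, 9, 10]), (6, 8, 0, [0, 1, 5, 6, 9, 10]), (6, 9, 0, [0, 1, 5, 6, 10, 11]),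
    (7, 5, 0, [3, 4, 6, 7, 8]), (7, 8, 0, [1, 2, 6, 7, 10, 11]), (3, 6, 1, [2, 3, 6, 7]),
    (3, 7, 1, [2, 3, 7, 8]), (3, 8, 1, [2, 3, 4, 7, 8]), (3, 9, 1, [2, 3, 4, 8, 9]),
    (4, 5, 1, [0, 1, 5, 6]), (4, 7, 1, [2, 3, 4, 8, 9]), (5, 5, 1, [3, 4, 9, 10]),
    (5, 6, 1, [3, 4, 5, 8, 9]), (5, 7, 1, [3, 4, 6, 8, 9]), (5, 8, 1, [0, 1, 5, 6, 9, 10]),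
    (6, 5, 1, [2, 3, 6, 7, 8]), (6, 6, 1, [2, 3, 6, 8, 12]), (6, 7, 1, [1, 2, 6, 7, 9, 10]),
    (6, 8, 1, [1, 2, 6, 7, 10, 11]), (7, 4, 1, [2, 3, 7, 8, 9]), (7, 5, 1, [2, 3, 7, 8, 9]),
    (7, 7, 1, [2, 3, 7, 8, 10, 11]), (8, 8, 1, [2, 3, 4, 8, 9, 12, 13]), (3, 5, 2, [2, 3, 5, 6]),
    (3, 7, 2, [2, 3, 5, 7, 8]), (4, 4, 2, [2, 3, 8, 9]), (4, 5, 2, [0, 1, 6, 7]),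
    (4, 6, 2, [0, 1, 6, 7, 8]), (5, 5, 2, [3, 4, 5, 7, 8]), (5, 6, 2, [0, 1, 7, 8, 9]),
    (5, 7, 2, [3, 4, 5, 7, 9, 10]), (5, 8, 2, [0, 1, 6, 7, 10, 11]),
    (6, 6, 2, [2, 3, 6, 7, 11, 12]), (6, 7, 2, [0, 4, 6, 8, 10, 11]),
    (6, 8, 2, [0, 1, 2, 7, 8, 11, 12]), (6, 9, 2, [0, 1, 2, 7, 8, 12, 13]),
    (7, 5, 2, [3, 4, 6, 8, 9, 10]), (7, 7, 2, [2, 3, 7, 8, 12, 13]),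
    (7, 8, 2, [1, 2, 6, 8, 9, 12, 13]), (3, 4, 3, [2, 3, 6, 7]), (3, 5, 3, [1, 2, 6, 7]),
    (3, 6, 3, [2, 3, 6, 7, 8]), (3, 8, 3, [0, 1, 5, 6, 9, 10]), (4, 4, 3, [2, 3, 7, 8]),
    (4, 5, 3, [2, 3, 4, 7, 8]), (4, 6, 3, [2, 3, 7, 8, 9]), (4, 7, 3, [0, 1, 6, 7, 9, 10]),
    (5, 3, 3, [3, 4, 8, 9]), (5, 5, 3, [3, 4, 8, 9]), (5, 6, 3, [0, 4, 5, 8, 9, 10]),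
    (6, 4, 3, [3, 4, 5, 9, 10]), (6, 6, 3, [0, 1, 5, 9, 10, 11]),
    (6, 7, 3, [1, 2, 6, 7, 9, 11, 12]), (7, 7, 3, [1, 2, 6, 8, 10, 12, 13]),
    (3, 4, 4, [2, 3, 7, 8]), (3, 6, 4, [2, 3, 7, 8, 9]), (3, 7, 4, [1, 2, 6, 7, 9, 10]),
    (4, 4, 4, [2, 3, 7, 8, 9]), (4, 5, 4, [2, 3, 4, 8, 9]), (4, 6, 4, [0, 3, 4, 8, 9, 10]),
    (4, 7, 4, [2, 3, 7, 8, 10, 11]), (5, 6, 4, [0, 4, 5, 9, 10, 11]),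
    (6, 3, 4, [0, 4, 6, 10, 11]), (6, 6, 4, [0, 1, 5, 6, 10, 11, 12]),
    (4, 6, 5, [0, 3, 7, 8, 11, 12]), (6, 6, 5, [3, 4, 5, 9, 10, 14, 15]),
    (3, 3, 6, [2, 3, 4, 8, 9]), (4, 4, 6, [2, 3, 7, 8, 12, 13]), (4, 5, 6, [0, 1, 5, 6, 10, 11]),
    (4, 6, 6, [0, 1, 5, 6, 10, 11, 12]), (4, 4, 7, [0, 1, 6, 7, 11, 12]),
    (4, 6, 7, [0, 1, 6, 7, 11, 12, 13])]

/-- Minimum disjunctive total dominating sets of the dumb-bells that have none of size at most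
`(n - 2) / 2`, in the format of `seeds`. -/
def exceptionalSets : List (ℕ × ℕ × ℕ × List ℕ) := [
    (3, 4, 0, [2, 3, 4]), (3, 3, 1, [2, 3, 4]), (4, 4, 0, [0, 3, 4, 5]), (3, 4, 1, [0, 1, 4, 5]),
    (3, 3, 2, [0, 1, 5, 6]), (4, 7, 2, [0, 1, 4, 6, 8, 9]), (3, 7, 3, [2, 3, 4, 6, 8, 9]),
    (4, 8, 1, [0, 1, 4, 5, 8, 9]), (3, 8, 2, [0, 1, 4, 5, 8, 9]), (4, 4, 5, [2, 3, 7, 8, 11, 12]),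
    (3, 4, 6, [0, 1, 4, 5, 9, 10]), (3, 3, 7, [0, 1, 5, 6, 10, 11]), (3, 3, 3, [0, 1, 5, 6]),
    (3, 4, 2, [0, 1, 5, 6]), (4, 4, 1, [0, 1, 5, 6]), (3, 5, 1, [0, 1, 4, 5]),
    (4, 5, 0, [0, 3, 4, 5]), (3, 6, 2, [0, 1, 5, 6, 7]), (4, 6, 1, [0, 1, 5, 6, 7])]

/-- The dumb-bells that have no disjunctive total dominating set of size at most `(n - 2) / 2`. -/
def exceptional : List (ℕ × ℕ × ℕ) :=
  exceptionalSets.map fun e => (e.1, e.2.1, e.2.2.1)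

theorem seeds_valid : ∀ e ∈ seeds, 3 ≤ e.1 ∧ 3 ≤ e.2.1 ∧
    IsChordDTDList (e.1 + e.2.1 + e.2.2.1) (e.1 - 1) (e.1 + e.2.2.1) e.2.2.2 := by
  decide +kernel

theorem exceptionalSets_valid : ∀ e ∈ exceptionalSets,
    2 * e.2.2.2.length ≤ e.1 + e.2.1 + e.2.2.1 ∧
    IsChordDTDList (e.1 + e.2.1 + e.2.2.1) (e.1 - 1) (e.1 + e.2.2.1) e.2.2.2 := by
  decide +kernel

/-! ### The lower bound for the exceptional dumb-bells -/

/-- For each vertex, the lists of the vertices at distance `1` and at distance `2`. -/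
def distLists (N a b : ℕ) : List (List ℕ × List ℕ) :=
  (List.range N).map fun v =>
    ((List.range N).filter (chordAdj N a b v ·), (List.range N).filter (chordDistTwo N a b v ·))

/-- Whether `T` meets the list `c.1` or has at least two elements in the list `c.2`. -/
def meets (T : List ℕ) (c : List ℕ × List ℕ) : Bool :=
  c.1.any (fun x => T.any (Nat.beq x)) ||
    match c.2.filter fun x => T.any (Nat.beq x) with
    | _ :: _ :: _ => true
    | _ => false

theorem IsChordDTDSet.all_meets {N a b : ℕ} {S : Finset ℕ} {T : List ℕ}
    (hS : IsChordDTDSet N a b S) (hT : ∀ x, x ∈ T ↔ x ∈ S) :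
    (distLists N a b).all (meets T) = true := by
  have mem_iff : ∀ x, T.any (Nat.beq x) = true ↔ x ∈ S := by
    intro x
    simp only [← hT, List.any_eq_true, Nat.beq_eq, exists_eq_right']
  rw [List.all_eq_true]
  intro c hc
  obtain ⟨v, hv, rfl⟩ := List.mem_map.1 hc
  rw [meets, Bool.or_eq_true]
  rcases hS.2 v (List.mem_range.1 hv) with ⟨u, hu, h⟩ | ⟨x, hx, y, hy, hxy, h, h'⟩
  · left
    rw [List.any_eq_true]
    refine ⟨u, ?_, (mem_iff u).2 hu⟩
    simpa using ⟨hS.1 u hu, h⟩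
  · right
    have hx' : x ∈ ((List.range N).filter (chordDistTwo N a b v ·)).filter
        fun x => T.any (Nat.beq x) := by
      simp only [List.mem_filter, List.mem_range, mem_iff, decide_eq_true_eq]
      exact ⟨⟨hS.1 x hx, h⟩, hx⟩
    have hy' : y ∈ ((List.range N).filter (chordDistTwo N a b v ·)).filter
        fun x => T.any (Nat.beq x) := by
      simp only [List.mem_filter, List.mem_range, mem_iff, decide_eq_true_eq]
      exact ⟨⟨hS.1 y hy, h'⟩, hy⟩
    split
    · rfl
    -- The filtered list has at most one entry here, yet contains the distinct vertices `x` and `y`.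
    · rename_i hne
      generalize ((List.range N).filter (chordDistTwo N a b v ·)).filter
        (fun x => T.any (Nat.beq x)) = L at hx' hy' hne
      match L, hx', hy', hne with
      | [z], hx', hy', _ => exact absurd ((List.mem_singleton.1 hx').trans
          (List.mem_singleton.1 hy').symm) hxy
      | z :: w :: L, _, _, hne => exact absurd rfl (hne z w L)

theorem IsChordDTDSet.mono {N a b : ℕ} {S T : Finset ℕ} (hS : IsChordDTDSet N a b S)
    (hST : S ⊆ T) (hT : ∀ x ∈ T, x < N) : IsChordDTDSet N a b T := by
  refine ⟨hT, fun v hv => ?_⟩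
  rcases hS.2 v hv with ⟨u, hu, h⟩ | ⟨x, hx, y, hy, h⟩
  · exact .inl ⟨u, hST hu, h⟩
  · exact .inr ⟨x, hST hx, y, hST hy, h⟩

/-- Only sets of size exactly `⌊n / 2⌋ - 1` need testing, because supersets of dominating sets
dominate (`IsChordDTDSet.mono`). With `n ≤ 13` there are at most `13.choose 5 = 1287` of them for
each graph. -/
theorem exceptional_sublists_not_meets : ∀ p ∈ exceptional,
    ((List.range (p.1 + p.2.1 + p.2.2)).sublistsLen ((p.1 + p.2.1 + p.2.2) / 2 - 1)).all
      (fun T => !(distLists (p.1 + p.2.1 + p.2.2) (p.1 - 1) (p.1 + p.2.2)).all (meets T)) =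
        true := by
  decide +kernel

theorem le_card_of_exceptional {n₁ n₂ l : ℕ} (hp : (n₁, n₂, l) ∈ exceptional) {S : Finset ℕ}
    (hS : IsChordDTDSet (n₁ + n₂ + l) (n₁ - 1) (n₁ + l) S) : (n₁ + n₂ + l) / 2 ≤ S.card := by
  by_contra! h
  have hsub : S ⊆ Finset.range (n₁ + n₂ + l) := fun x hx => Finset.mem_range.2 (hS.1 x hx)
  -- A smaller set is padded to the size covered by the enumeration.
  obtain ⟨T, hST, hTN, hc⟩ := Finset.exists_subsuperset_card_eq (n := (n₁ + n₂ + l) / 2 - 1) hsub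
    (by omega) (by rw [Finset.card_range]; omega)
  have hT := hS.mono hST fun x hx => Finset.mem_range.1 (hTN hx)
  have hmem : ∀ x, x ∈ (List.range (n₁ + n₂ + l)).filter (· ∈ T) ↔ x ∈ T := by
    intro x
    simp only [List.mem_filter, List.mem_range, decide_eq_true_eq, and_iff_right_iff_imp]
    exact hT.1 x
  have hnd : ((List.range (n₁ + n₂ + l)).filter (· ∈ T)).Nodup := List.nodup_range.filter _
  have hlen : ((List.range (n₁ + n₂ + l)).filter (· ∈ T)).length = (n₁ + n₂ + l) / 2 - 1 := by
    rw [← List.toFinset_card_of_nodup hnd, ← hc]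
    congr 1
    ext x
    rw [List.mem_toFinset, hmem]
  have := List.all_eq_true.1 (exceptional_sublists_not_meets _ hp) _
    (List.mem_sublistsLen.2 ⟨List.filter_sublist, hlen⟩)
  rw [hT.all_meets hmem] at this
  exact absurd this (by decide)

/-! ### All dumb-bells but finitely many -/

/-- Whether `T` contains both ends of an edge `{i, i + 1}` with `p ≤ i < q`. -/
def hasEdge (T : List ℕ) (p q : ℕ) : Bool :=
  T.any fun i => decide (p ≤ i) && (decide (i < q) && T.any (Nat.beq (i + 1)))

theorem HasEdge.of_hasEdge {T : List ℕ} {p q : ℕ} (h : hasEdge T p q = true) :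
    HasEdge T.toFinset p q := by
  simp only [hasEdge, List.any_eq_true, Bool.and_eq_true, decide_eq_true_eq, Nat.beq_eq] at h
  obtain ⟨i, hi, hp, hq, j, hj, rfl⟩ := h
  exact ⟨i, hp, hq, List.mem_toFinset.2 hi, List.mem_toFinset.2 hj⟩

/-- The size `x` can be increased to `y` by steps of `4` and `5`, which are allowed only if `m` is
true; moreover `m` is true if `y` is not less than `t`. -/
def Reaches (x y t : ℕ) (m : Bool) : Prop :=
  x ≤ y ∧ 5 * ((y - x) % 4) ≤ y - x ∧ (y = x ∧ y < t ∨ m = true)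

instance (x y t : ℕ) (m : Bool) : Decidable (Reaches x y t m) := by
  unfold Reaches; infer_instance

/-- The entry `e` of `seeds` yields a set of size at most `(n - 2) / 2` for `D_b(n₁, n₂, l)`. -/
def Covers (e : ℕ × ℕ × ℕ × List ℕ) (n₁ n₂ l : ℕ) : Prop :=
  Reaches e.1 n₁ 9 (hasEdge e.2.2.2 0 (e.1 - 1)) ∧
  Reaches e.2.1 n₂ 9 (hasEdge e.2.2.2 (e.1 + e.2.2.1) (e.1 + e.2.1 + e.2.2.1 - 1)) ∧
  Reaches e.2.2.1 l 8 (hasEdge e.2.2.2 (e.1 - 1) (e.1 + e.2.2.1)) ∧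
  2 * e.2.2.2.length + 2 ≤ e.1 + e.2.1 + e.2.2.1 +
    ((n₁ - e.1) % 4 + (n₂ - e.2.1) % 4 + (l - e.2.2.1) % 4)

instance (e : ℕ × ℕ × ℕ × List ℕ) (n₁ n₂ l : ℕ) : Decidable (Covers e n₁ n₂ l) := by
  unfold Covers; infer_instance

/-- The bounds 13 and 12 are the thresholds 9 and 8 of `Covers` plus 4, so that all residues modulo
4 occur beyond the thresholds. Pairs with `n₁ > n₂` are needed when both are at least 9, because
reduction modulo 4 can reverse the order of two long cycles. -/
theorem all_covered : ((List.range 13).all fun n₁ => (List.range 13).all fun n₂ =>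
    (List.range 12).all fun l => decide
      ((3 ≤ n₁ ∧ 3 ≤ n₂ ∧ (n₁ ≤ n₂ ∨ 9 ≤ n₁ ∧ 9 ≤ n₂)) ∧ (n₁, n₂, l) ∉ exceptional →
        (seeds.any fun e => Covers e n₁ n₂ l) = true)) = true := by
  decide +kernel

theorem exists_covers {n₁ n₂ l : ℕ} (h₁ : 3 ≤ n₁) (h₂ : 3 ≤ n₂) (k₁ : n₁ < 13)
    (k₂ : n₂ < 13) (k₃ : l < 12) (hle : n₁ ≤ n₂ ∨ 9 ≤ n₁ ∧ 9 ≤ n₂)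
    (hex : (n₁, n₂, l) ∉ exceptional) : ∃ e ∈ seeds, Covers e n₁ n₂ l := by
  have h := all_covered
  simp only [List.all_eq_true, List.mem_range, decide_eq_true_eq, List.any_eq_true] at h
  exact h n₁ k₁ n₂ k₂ l k₃ ⟨⟨h₁, h₂, hle⟩, hex⟩

theorem HasSlackSet.weaken {n₁ n₂ l s s' : ℕ} {m₁ m₂ m₃ : Bool} (hs : s' ≤ s)
    (h : HasSlackSet n₁ n₂ l s m₁ m₂ m₃) : HasSlackSet n₁ n₂ l s' m₁ m₂ m₃ := by
  obtain ⟨S, h₁, h₂, h₃⟩ := h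
  exact ⟨S, h₁, by omega, h₃⟩

theorem HasSlackSet.reach {n₁ n₂ l n₁' n₂' l' s t₁ t₂ t₃ : ℕ} {m₁ m₂ m₃ : Bool} (h₁ : 3 ≤ n₁)
    (h₂ : 3 ≤ n₂) (r₁ : Reaches n₁ n₁' t₁ m₁) (r₂ : Reaches n₂ n₂' t₂ m₂)
    (r₃ : Reaches l l' t₃ m₃) (h : HasSlackSet n₁ n₂ l s m₁ m₂ m₃) :
    HasSlackSet n₁' n₂' l' (s + (n₁' - n₁) % 4 + (n₂' - n₂) % 4 + (l' - l) % 4) m₁ m₂ m₃ := by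
  obtain ⟨a₁, b₁, c₁⟩ := r₁
  obtain ⟨a₂, b₂, c₂⟩ := r₂
  obtain ⟨a₃, b₃, c₃⟩ := r₃
  have := ((h.grow_fst h₁ h₂ b₁ (c₁.imp_left (by omega))).grow_snd (by omega) h₂ b₂
    (c₂.imp_left (by omega))).grow_path (by omega) (by omega) b₃ (c₃.imp_left (by omega))
  rwa [Nat.add_sub_cancel' a₁, Nat.add_sub_cancel' a₂, Nat.add_sub_cancel' a₃] at this

theorem HasSlackSet.of_seed {e : ℕ × ℕ × ℕ × List ℕ} (he : e ∈ seeds) {s : ℕ}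
    (hs : 2 * e.2.2.2.length + s ≤ e.1 + e.2.1 + e.2.2.1) :
    HasSlackSet e.1 e.2.1 e.2.2.1 s (hasEdge e.2.2.2 0 (e.1 - 1))
      (hasEdge e.2.2.2 (e.1 + e.2.2.1) (e.1 + e.2.1 + e.2.2.1 - 1))
      (hasEdge e.2.2.2 (e.1 - 1) (e.1 + e.2.2.1)) :=
  ⟨e.2.2.2.toFinset, isChordDTDSet_toFinset.2 (seeds_valid e he).2.2,
    by have := List.toFinset_card_le e.2.2.2; omega, .of_hasEdge, .of_hasEdge, .of_hasEdge⟩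

/-- Seeds need only nonnegative slack, as steps of 5 can supply the rest. The bound makes the
subtraction that defines the slack in `HasSlackSet.of_bounded` exact. -/
theorem seeds_size : ∀ e ∈ seeds, 2 * e.2.2.2.length ≤ e.1 + e.2.1 + e.2.2.1 := by
  decide +kernel

/-- A dumb-bell with cycles and path of moderate size that is not exceptional has a disjunctive
total dominating set of size at most `(n - 2) / 2`, which allows to enlarge the long parts. -/
theorem HasSlackSet.of_bounded {n₁ n₂ l : ℕ} (h₁ : 3 ≤ n₁) (h₂ : 3 ≤ n₂) (k₁ : n₁ < 13)
    (k₂ : n₂ < 13) (k₃ : l < 12) (hle : n₁ ≤ n₂ ∨ 9 ≤ n₁ ∧ 9 ≤ n₂)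
    (hex : (n₁, n₂, l) ∉ exceptional) :
    ∃ m₁ m₂ m₃, HasSlackSet n₁ n₂ l 2 m₁ m₂ m₃ ∧ (9 ≤ n₁ → m₁ = true) ∧ (9 ≤ n₂ → m₂ = true) ∧
      (8 ≤ l → m₃ = true) := by
  obtain ⟨e, he, c₁, c₂, c₃, hs⟩ := exists_covers h₁ h₂ k₁ k₂ k₃ hle hex
  refine ⟨_, _, _, ((HasSlackSet.of_seed he (s := e.1 + e.2.1 + e.2.2.1 - 2 * e.2.2.2.length)
    ?_).reach (seeds_valid e he).1 (seeds_valid e he).2.1 c₁ c₂ c₃).weaken ?_, ?_, ?_, ?_⟩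
  · have := seeds_size e he
    omega
  · have := seeds_size e he
    omega
  · intro h
    exact c₁.2.2.resolve_left (by omega)
  · intro h
    exact c₂.2.2.resolve_left (by omega)
  · intro h
    exact c₃.2.2.resolve_left (by omega)

theorem exceptional_bounded : ∀ p ∈ exceptional,
    3 ≤ p.1 ∧ p.1 < 9 ∧ 3 ≤ p.2.1 ∧ p.2.1 < 9 ∧ p.2.2 < 8 := by
  decide +kernel

/-- The representative of `n` modulo `4` among `t, …, t + 3` if `n` is larger than these. -/
theorem exists_reduced (n t : ℕ) : ∃ r, r ≤ n ∧ (n - r) % 4 = 0 ∧ r < t + 4 ∧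
    (t ≤ n → t ≤ r) ∧ (n < t + 4 → r = n) := by
  by_cases h : n < t + 4
  · exact ⟨n, by omega⟩
  · exact ⟨t + (n - t) % 4, by omega⟩

/-- Each length is reduced by a multiple of 4 into the finite box and then restored by steps of 4,
which keep the slack. A part that was shortened is beyond its threshold, so it contains an edge to
subdivide. -/
theorem HasSlackSet.of_not_exceptional {n₁ n₂ l : ℕ} (h₁ : 3 ≤ n₁) (hle : n₁ ≤ n₂)
    (hex : (n₁, n₂, l) ∉ exceptional) : ∃ m₁ m₂ m₃, HasSlackSet n₁ n₂ l 2 m₁ m₂ m₃ := by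
  obtain ⟨r₁, a₁, b₁, c₁, d₁, e₁⟩ := exists_reduced n₁ 9
  obtain ⟨r₂, a₂, b₂, c₂, d₂, e₂⟩ := exists_reduced n₂ 9
  obtain ⟨r₃, a₃, b₃, c₃, d₃, e₃⟩ := exists_reduced l 8
  -- Exceptional lengths lie below the thresholds, where reduction changes nothing.
  have hr : (r₁, r₂, r₃) ∉ exceptional := by
    intro h
    have := exceptional_bounded _ h
    simp only at this
    rw [← e₁ (by omega), ← e₂ (by omega), ← e₃ (by omega)] at hex
    exact hex h
  obtain ⟨m₁, m₂, m₃, h, k₁, k₂, k₃⟩ := HasSlackSet.of_bounded (by omega) (by omega) c₁ c₂ c₃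
    (by omega) hr
  refine ⟨m₁, m₂, m₃, (h.reach (t₁ := 9) (t₂ := 9) (t₃ := 8) (by omega) (by omega)
    ⟨a₁, by omega, ?_⟩ ⟨a₂, by omega, ?_⟩ ⟨a₃, by omega, ?_⟩).weaken (by omega)⟩
  · by_cases h : 9 ≤ n₁
    · exact .inr (k₁ (d₁ h))
    · exact .inl (by omega)
  · by_cases h : 9 ≤ n₂
    · exact .inr (k₂ (d₂ h))
    · exact .inl (by omega)
  · by_cases h : 8 ≤ l
    · exact .inr (k₃ (d₃ h))
    · exact .inl (by omega)

theorem two_mul_dtdNumber_add_two_le {n₁ n₂ l : ℕ} (h₁ : 3 ≤ n₁) (hle : n₁ ≤ n₂)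
    (hex : (n₁, n₂, l) ∉ exceptional) :
    2 * dtdNumber (dumbbell n₁ n₂ l) + 2 ≤ n₁ + n₂ + l := by
  obtain ⟨-, -, -, S, hS, hs, -⟩ := HasSlackSet.of_not_exceptional h₁ hle hex
  have := dtdNumber_dumbbell_le h₁ (by omega) hS
  omega

theorem dtdNumber_exceptional {n₁ n₂ l : ℕ} (hp : (n₁, n₂, l) ∈ exceptional) :
    2 * dtdNumber (dumbbell n₁ n₂ l) ≤ n₁ + n₂ + l ∧
      n₁ + n₂ + l ≤ 2 * dtdNumber (dumbbell n₁ n₂ l) + 1 := by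
  obtain ⟨h₁, -, h₂, -⟩ := exceptional_bounded _ hp
  obtain ⟨e, he, h⟩ := List.mem_map.1 hp
  obtain ⟨hlen, hT⟩ := exceptionalSets_valid e he
  simp only [Prod.mk.injEq] at h
  obtain ⟨rfl, rfl, rfl⟩ := h
  rw [← isChordDTDSet_toFinset] at hT
  have hle : dtdNumber (dumbbell e.1 e.2.1 e.2.2.1) ≤ _ := dtdNumber_dumbbell_le h₁ h₂ hT
  obtain ⟨S, hS, hc⟩ : ∃ S : Finset ℕ, _ ∧ S.card = dtdNumber (dumbbell e.1 e.2.1 e.2.2.1) :=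
    exists_chordDTDSet_card_eq h₁ h₂ hT
  have := le_card_of_exceptional hp hS
  have := List.toFinset_card_le e.2.2.2
  omega

/-! ### Branch vertices -/

/-- The vertex `x` has at least three neighbours. -/
def IsBranch {V : Type*} (G : SimpleGraph V) (x : V) : Prop :=
  ∃ u v w, (u ≠ v ∧ u ≠ w ∧ v ≠ w) ∧ G.Adj x u ∧ G.Adj x v ∧ G.Adj x w

instance {V : Type*} [Fintype V] [DecidableEq V] (G : SimpleGraph V) [DecidableRel G.Adj] (x : V) :
    Decidable (IsBranch G x) := by
  unfold IsBranch; infer_instance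

theorem IsBranch.map {V W : Type*} {G : SimpleGraph V} {H : SimpleGraph W} (f : V → W)
    (hf : Function.Injective f) (hadj : ∀ x y, G.Adj x y → H.Adj (f x) (f y)) {x : V}
    (h : IsBranch G x) : IsBranch H (f x) := by
  obtain ⟨u, v, w, ⟨h₁, h₂, h₃⟩, a₁, a₂, a₃⟩ := h
  exact ⟨f u, f v, f w, ⟨hf.ne h₁, hf.ne h₂, hf.ne h₃⟩, hadj _ _ a₁, hadj _ _ a₂, hadj _ _ a₃⟩

/-- Only the attachment vertices `a` and `b` of the cycles can have degree 3. -/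
theorem chordAdj_mem_pair {N a b x : ℕ} (ha : x ≠ a) (hb : x ≠ b) :
    ∃ s t, ∀ y, chordAdj N a b x y → y = s ∨ y = t := by
  by_cases h0 : x = 0
  · refine ⟨1, if x + 1 = N then b else a, fun y h => ?_⟩
    unfold chordAdj at h
    split_ifs <;> omega
  by_cases hN : x + 1 = N
  · refine ⟨x - 1, b, fun y h => ?_⟩
    unfold chordAdj at h
    omega
  · refine ⟨x - 1, x + 1, fun y h => ?_⟩
    unfold chordAdj at h
    omega

theorem chordAdj_mem_triple {N a b x : ℕ} (hab : a < b) (hb : b + 1 < N) :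
    ∃ r s t, ∀ y, chordAdj N a b x y → y = r ∨ y = s ∨ y = t := by
  by_cases hxa : x = a
  · refine ⟨0, a - 1, a + 1, fun y h => ?_⟩
    unfold chordAdj at h
    omega
  by_cases hxb : x = b
  · refine ⟨N - 1, b - 1, b + 1, fun y h => ?_⟩
    unfold chordAdj at h
    omega
  obtain ⟨s, t, h⟩ := chordAdj_mem_pair (N := N) hxa hxb
  exact ⟨s, s, t, fun y hy => .inr (h y hy)⟩

theorem IsDumbbell.branch_cases {V : Type*} {G : SimpleGraph V} (hG : IsDumbbell G) :
    ∃ p q : V, ∀ x, IsBranch G x → x = p ∨ x = q := by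
  obtain ⟨n₁, n₂, l, h₁, h₂, ⟨e⟩⟩ := hG
  obtain ⟨p, hp⟩ := exists_position_eq (n₁ := n₁) (n₂ := n₂) (l := l) (k := n₁ - 1) (by omega)
  obtain ⟨q, hq⟩ := exists_position_eq (n₁ := n₁) (n₂ := n₂) (l := l) (k := n₁ + l) (by omega)
  refine ⟨e.symm p, e.symm q, ?_⟩
  intro x hx
  have hinj := position_injective n₁ n₂ l
  obtain ⟨u, v, w, ⟨k₁, k₂, k₃⟩, a₁, a₂, a₃⟩ := hx.map (H := dumbbell n₁ n₂ l) e e.injective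
    fun _ _ => e.map_adj_iff.2
  rw [dumbbell_adj_iff h₁ h₂] at a₁ a₂ a₃
  rw [← hinj.ne_iff] at k₁ k₂ k₃
  by_contra! h
  obtain ⟨s, t, hst⟩ := chordAdj_mem_pair (N := n₁ + n₂ + l) (a := n₁ - 1) (b := n₁ + l)
    (x := position n₁ n₂ l (e x))
    (fun h' => h.1 (by rw [← hinj (h'.trans hp.symm), e.symm_apply_apply]))
    (fun h' => h.2 (by rw [← hinj (h'.trans hq.symm), e.symm_apply_apply]))
  have := hst _ a₁
  have := hst _ a₂
  have := hst _ a₃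
  omega

theorem IsDumbbell.not_four_adj {V : Type*} {G : SimpleGraph V} (hG : IsDumbbell G) {x : V}
    (f : Fin 4 → V) (hf : Function.Injective f) : ¬ ∀ i, G.Adj x (f i) := by
  intro h
  obtain ⟨n₁, n₂, l, h₁, h₂, ⟨e⟩⟩ := hG
  obtain ⟨r, s, t, hrst⟩ := chordAdj_mem_triple (N := n₁ + n₂ + l) (a := n₁ - 1) (b := n₁ + l)
    (x := position n₁ n₂ l (e x)) (by omega) (by omega)
  have key : ∀ i, position n₁ n₂ l (e (f i)) ∈ ({r, s, t} : Finset ℕ) := by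
    intro i
    have := hrst _ ((dumbbell_adj_iff h₁ h₂ _ _).1 (e.map_adj_iff.2 (h i)))
    simpa using this
  have := Finset.card_le_card_of_injOn (s := Finset.univ) _ (fun i _ => key i)
    ((position_injective n₁ n₂ l).comp (e.injective.comp hf)).injOn
  have := Finset.card_le_three (a := r) (b := s) (c := t)
  simp only [Finset.card_univ, Fintype.card_fin] at *
  omega

theorem IsDumbbell.card_le_two {V ι : Type*} [Fintype ι] {G : SimpleGraph V} (hG : IsDumbbell G)
    (f : ι → V) (hf : Function.Injective f) (h : ∀ i, IsBranch G (f i)) : Fintype.card ι ≤ 2 := by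
  classical
  obtain ⟨p, q, hpq⟩ := hG.branch_cases
  rw [← Finset.card_univ, ← Finset.card_image_of_injective _ hf]
  refine (Finset.card_le_card (t := {p, q}) ?_).trans Finset.card_le_two
  intro x hx
  obtain ⟨i, -, rfl⟩ := Finset.mem_image.1 hx
  simpa using hpq _ (h i)

theorem IsDumbbell.congr {V W : Type*} {G : SimpleGraph V} {H : SimpleGraph W} (e : G ≃g H)
    (hG : IsDumbbell G) : IsDumbbell H := by
  obtain ⟨n₁, n₂, l, h₁, h₂, ⟨d⟩⟩ := hG
  exact ⟨n₁, n₂, l, h₁, h₂, ⟨e.symm.trans d⟩⟩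

/-! ### Amalgams of linked graphs -/

section Amalgam

variable {ι : Type} (F : ι → LinkedGraph)

theorem linkCopy_injective (i : ι) : Function.Injective (linkCopy F i) := by
  intro u v
  refine Fin.cases ?_ (fun u => ?_) u <;> refine Fin.cases ?_ (fun v => ?_) v <;>
    simp [linkCopy]

/-- Different copies meet only in the link vertex, so branch vertices away from it are distinct for
distinct units. -/
theorem linkCopy_index {i j : ι} {u : Fin ((F i).size + 1)} {v : Fin ((F j).size + 1)}
    (hu : u ≠ 0) (h : linkCopy F i u = linkCopy F j v) : i = j := by
  obtain ⟨u, rfl⟩ := Fin.exists_succ_eq.2 hu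
  revert h
  refine Fin.cases ?_ (fun v => ?_) v
  · simp [linkCopy]
  · simp only [linkCopy, Fin.cases_succ, Option.some.injEq, Sigma.mk.injEq]
    exact fun h => h.1

theorem amalgam_adj {x y : Option (Σ i, Fin (F i).size)} :
    (amalgam F).Adj x y ↔
      ∃ i u v, (F i).graph.Adj u v ∧ linkCopy F i u = x ∧ linkCopy F i v = y := by
  simp only [amalgam, SimpleGraph.iSup_adj, SimpleGraph.map_adj']
  refine exists_congr fun i => ⟨And.right, fun h => ⟨?_, h⟩⟩
  obtain ⟨u, v, h, rfl, rfl⟩ := h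
  exact (linkCopy_injective F i).ne h.ne

theorem amalgam_adj_linkCopy {i : ι} {u v : Fin ((F i).size + 1)} (h : (F i).graph.Adj u v) :
    (amalgam F).Adj (linkCopy F i u) (linkCopy F i v) :=
  (amalgam_adj F).2 ⟨i, u, v, h, rfl, rfl⟩

theorem IsBranch.linkCopy {i : ι} {u : Fin ((F i).size + 1)} (h : IsBranch (F i).graph u) :
    IsBranch (amalgam F) (linkCopy F i u) :=
  h.map _ (linkCopy_injective F i) fun _ _ => amalgam_adj_linkCopy F

theorem IsDumbbell.card_index_le_two [Fintype ι] (hG : IsDumbbell (amalgam F))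
    (h : ∀ i, ∃ u, u ≠ 0 ∧ IsBranch (F i).graph u) : Fintype.card ι ≤ 2 := by
  choose u hu hb using h
  exact hG.card_le_two (fun i => linkCopy F i (u i)) (fun i j hij => linkCopy_index F (hu i) hij)
    fun i => (hb i).linkCopy F

instance [Fintype ι] [DecidableEq ι] [∀ i, DecidableRel (F i).graph.Adj] :
    DecidableRel (amalgam F).Adj := fun _ _ => decidable_of_iff _ (amalgam_adj F).symm

end Amalgam

/-! ### Branch vertices of the units, and the seven amalgams that are dumb-bells -/

instance (m : ℕ) (E : List (ℕ × ℕ)) : DecidableRel (LinkedGraph.ofEdges m E).graph.Adj := by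
  unfold LinkedGraph.ofEdges
  infer_instance

instance : DecidableRel U₁.graph.Adj := by unfold U₁; infer_instance
instance : DecidableRel U₂.graph.Adj := by unfold U₂; infer_instance
instance : DecidableRel X₁.graph.Adj := by unfold X₁; infer_instance
instance : DecidableRel X₂.graph.Adj := by unfold X₂; infer_instance
instance : DecidableRel X₃.graph.Adj := by unfold X₃; infer_instance
instance : DecidableRel X₄.graph.Adj := by unfold X₄; infer_instance
instance : DecidableRel X₅.graph.Adj := by unfold X₅; infer_instance
instance : DecidableRel X₆.graph.Adj := by unfold X₆; infer_instance

instance {α β : Type} (f : α → LinkedGraph) (g : β → LinkedGraph)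
    [hf : ∀ i, DecidableRel (f i).graph.Adj] [hg : ∀ i, DecidableRel (g i).graph.Adj]
    (i : α ⊕ β) : DecidableRel (Sum.elim f g i).graph.Adj :=
  match i with
  | .inl i => hf i
  | .inr i => hg i

theorem U₁_branch : ∃ u, u ≠ 0 ∧ IsBranch U₁.graph u := by decide +kernel

theorem U₂_branch : ∃ u, u ≠ 0 ∧ IsBranch U₂.graph u := by decide +kernel

theorem X₂_branch : ∃ u, u ≠ 0 ∧ IsBranch X₂.graph u := by decide +kernel

theorem X₃_branch : ∃ f : Fin 3 → Fin (X₃.size + 1), Function.Injective f ∧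
    ∀ i, IsBranch X₃.graph (f i) :=
  ⟨![1, 3, 6], by decide +kernel⟩

theorem X₅_branch : ∃ f : Fin 3 → Fin (X₅.size + 1), Function.Injective f ∧
    ∀ i, IsBranch X₅.graph (f i) :=
  ⟨![1, 2, 6], by decide +kernel⟩

theorem X₄_four_adj : ∃ (x : Fin (X₄.size + 1)) (f : Fin 4 → Fin (X₄.size + 1)),
    Function.Injective f ∧ ∀ i, X₄.graph.Adj x (f i) :=
  ⟨1, ![0, 2, 6, 8], by decide +kernel⟩

theorem X₆_four_adj : ∃ (x : Fin (X₆.size + 1)) (f : Fin 4 → Fin (X₆.size + 1)),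
    Function.Injective f ∧ ∀ i, X₆.graph.Adj x (f i) :=
  ⟨1, ![0, 2, 6, 8], by decide +kernel⟩

/-- A graph is a dumb-bell if its vertices can be numbered along a Hamiltonian path whose ends
are also the ends of the only two other edges. -/
theorem nonempty_iso_dumbbell {W : Type*} {H : SimpleGraph W} {n₁ n₂ l : ℕ} (h₁ : 3 ≤ n₁)
    (h₂ : 3 ≤ n₂) (code : W → ℕ) (hinj : Function.Injective code)
    (hlt : ∀ w, code w < n₁ + n₂ + l) (hsurj : ∀ k < n₁ + n₂ + l, ∃ w, code w = k)
    (hadj : ∀ x y, H.Adj x y ↔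
      chordAdj (n₁ + n₂ + l) (n₁ - 1) (n₁ + l) (code x) (code y)) :
    Nonempty (H ≃g dumbbell n₁ n₂ l) := by
  choose f hf using fun w => exists_position_eq (hlt w)
  have hbij : Function.Bijective f := by
    constructor
    · intro x y h
      apply hinj
      rw [← hf, ← hf, h]
    · intro x
      obtain ⟨w, hw⟩ := hsurj _ (position_lt x)
      exact ⟨w, position_injective _ _ _ ((hf w).trans hw)⟩
  refine ⟨⟨Equiv.ofBijective f hbij, ?_⟩⟩
  intro x y
  rw [Equiv.ofBijective_apply, Equiv.ofBijective_apply, dumbbell_adj_iff h₁ h₂, hf, hf, hadj]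

/-- The numbering of the vertices of an amalgam of two linked graphs along a Hamiltonian path.
The linked graph with index `i` has four vertices besides the link vertex. -/
def amalgamCode {ι : Type} [DecidableEq ι] (F : ι → LinkedGraph) (i : ι) :
    Option (Σ i, Fin (F i).size) → ℕ
  | none => 4
  -- Here `v` stands for vertex `v + 1` of its unit. The unit `i` is traversed backwards to the link
  -- vertex at 4, and the other unit forwards from there.
  | some ⟨j, v⟩ => if j = i then 3 - v.val else 5 + v.val

theorem nonempty_amalgam_iso_dumbbell {ι : Type} [DecidableEq ι] (F : ι → LinkedGraph) (i : ι)
    {n₁ n₂ l : ℕ} (h₁ : 3 ≤ n₁) (h₂ : 3 ≤ n₂)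
    (h : Function.Injective (amalgamCode F i) ∧ (∀ w, amalgamCode F i w < n₁ + n₂ + l) ∧
      (∀ k < n₁ + n₂ + l, ∃ w, amalgamCode F i w = k) ∧
      ∀ x y, (amalgam F).Adj x y ↔ chordAdj (n₁ + n₂ + l) (n₁ - 1) (n₁ + l)
        (amalgamCode F i x) (amalgamCode F i y)) :
    Nonempty (amalgam F ≃g dumbbell n₁ n₂ l) :=
  nonempty_iso_dumbbell h₁ h₂ _ h.1 h.2.1 h.2.2.1 h.2.2.2

theorem nonempty_unitGraph_two_zero :
    Nonempty (unitGraph 2 0 ≃g dumbbell 3 3 3) := by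
  unfold unitGraph
  exact nonempty_amalgam_iso_dumbbell _ (.inl 0) (by decide) (by decide) (by decide +kernel)

theorem nonempty_unitGraph_one_one :
    Nonempty (unitGraph 1 1 ≃g dumbbell 3 4 2) := by
  unfold unitGraph
  exact nonempty_amalgam_iso_dumbbell _ (.inl 0) (by decide) (by decide) (by decide +kernel)

theorem nonempty_unitGraph_zero_two :
    Nonempty (unitGraph 0 2 ≃g dumbbell 4 4 1) := by
  unfold unitGraph
  exact nonempty_amalgam_iso_dumbbell _ (.inr 0) (by decide) (by decide) (by decide +kernel)

theorem nonempty_unitGraphWith_X₁_one_zero :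
    Nonempty (unitGraphWith X₁ 1 0 ≃g dumbbell 3 5 1) := by
  unfold unitGraphWith
  exact nonempty_amalgam_iso_dumbbell _ (.inl (.inl 0)) (by decide) (by decide) (by decide +kernel)

theorem nonempty_unitGraphWith_X₁_zero_one :
    Nonempty (unitGraphWith X₁ 0 1 ≃g dumbbell 4 5 0) := by
  unfold unitGraphWith
  exact nonempty_amalgam_iso_dumbbell _ (.inl (.inr 0)) (by decide) (by decide) (by decide +kernel)

theorem nonempty_unitGraphWith_X₂_one_zero :
    Nonempty (unitGraphWith X₂ 1 0 ≃g dumbbell 3 6 2) := by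
  unfold unitGraphWith
  exact nonempty_amalgam_iso_dumbbell _ (.inl (.inl 0)) (by decide) (by decide) (by decide +kernel)

theorem nonempty_unitGraphWith_X₂_zero_one :
    Nonempty (unitGraphWith X₂ 0 1 ≃g dumbbell 4 6 1) := by
  unfold unitGraphWith
  exact nonempty_amalgam_iso_dumbbell _ (.inl (.inr 0)) (by decide) (by decide) (by decide +kernel)

/-! ### The dumb-bells in the family `𝓖` -/

theorem card_unitGraph_le {n₁ n₂ : ℕ} (h : IsDumbbell (unitGraph n₁ n₂)) : n₁ + n₂ ≤ 2 := by
  have := IsDumbbell.card_index_le_two _ h (by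
    rintro (i | i)
    · exact U₁_branch
    · exact U₂_branch)
  simpa using this

/-- The linked graphs of which `unitGraphWith X n₁ n₂` is made. -/
abbrev units (X : LinkedGraph) (n₁ n₂ : ℕ) : (Fin n₁ ⊕ Fin n₂) ⊕ Fin 1 → LinkedGraph :=
  Sum.elim (Sum.elim (fun _ => U₁) (fun _ => U₂)) (fun _ => X)

/-- The link vertex of the amalgam has three neighbours if one of the units is `X₁`. -/
theorem isBranch_link_X₁ {n₁ n₂ : ℕ} (h : 1 ≤ n₁ + n₂) :
    IsBranch (unitGraphWith X₁ n₁ n₂) none := by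
  have hX : X₁.graph.Adj 0 1 ∧ X₁.graph.Adj 0 4 ∧ (1 : Fin (X₁.size + 1)) ≠ 4 := by
    decide +kernel
  have hU : ∀ i : Fin n₁ ⊕ Fin n₂, ∃ u,
      (units X₁ n₁ n₂ (.inl i)).graph.Adj 0 u := by
    rintro (i | i)
    · exact (by decide +kernel : ∃ u, U₁.graph.Adj 0 u)
    · exact (by decide +kernel : ∃ u, U₂.graph.Adj 0 u)
  obtain ⟨i⟩ : Nonempty (Fin n₁ ⊕ Fin n₂) := by
    rw [← Fintype.card_pos_iff]
    simpa [Nat.pos_iff_ne_zero, Nat.one_le_iff_ne_zero, imp_iff_not_or] using h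
  obtain ⟨u, hu⟩ := hU i
  refine ⟨linkCopy (units X₁ n₁ n₂) (.inl i) u,
    linkCopy (units X₁ n₁ n₂) (.inr 0) (1 : Fin (X₁.size + 1)),
    linkCopy (units X₁ n₁ n₂) (.inr 0) (4 : Fin (X₁.size + 1)), ⟨?_, ?_, ?_⟩,
    amalgam_adj_linkCopy (units X₁ n₁ n₂) hu,
    amalgam_adj_linkCopy (units X₁ n₁ n₂) (i := .inr 0) hX.1,
    amalgam_adj_linkCopy (units X₁ n₁ n₂) (i := .inr 0) hX.2.1⟩
  · intro h
    have := linkCopy_index _ hu.ne' h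
    simp at this
  · intro h
    have := linkCopy_index _ hu.ne' h
    simp at this
  · exact (linkCopy_injective _ _).ne hX.2.2

/-- The unit `X₁` has no branch vertex of its own, but it makes the link vertex one. In the index
type `Option _`, `none` stands for the link vertex and `some i` for the branch vertex of the unit
`i`. -/
theorem card_unitGraphWith_X₁_le {n₁ n₂ : ℕ} (hn : 1 ≤ n₁ + n₂)
    (h : IsDumbbell (unitGraphWith X₁ n₁ n₂)) : n₁ + n₂ ≤ 1 := by
  have hU : ∀ i : Fin n₁ ⊕ Fin n₂, ∃ u, u ≠ 0 ∧ IsBranch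
      (units X₁ n₁ n₂ (.inl i)).graph u := by
    rintro (i | i)
    · exact U₁_branch
    · exact U₂_branch
  choose u hu hb using hU
  have := h.card_le_two (ι := Option (Fin n₁ ⊕ Fin n₂))
    (fun i => i.elim none fun i => linkCopy _ (.inl i) (u i)) ?_ ?_
  · simpa using this
  · have hnone : ∀ i, none ≠ linkCopy (units X₁ n₁ n₂) (.inl i) (u i) := fun i h' =>
      hu i (linkCopy_injective _ _ (h'.symm.trans rfl))
    rintro (_ | i) (_ | j) hij
    · rfl
    · exact absurd hij (hnone j)
    · exact absurd hij.symm (hnone i)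
    · exact congrArg some (Sum.inl_injective (linkCopy_index _ (hu i) hij))
  · rintro (_ | i)
    · exact isBranch_link_X₁ hn
    · exact (hb i).linkCopy _

theorem card_unitGraphWith_X₂_le {n₁ n₂ : ℕ} (h : IsDumbbell (unitGraphWith X₂ n₁ n₂)) :
    n₁ + n₂ ≤ 1 := by
  have := IsDumbbell.card_index_le_two _ h (by
    rintro ((i | i) | i)
    · exact U₁_branch
    · exact U₂_branch
    · exact X₂_branch)
  simpa using this

theorem not_isDumbbell_of_three_branch {X : LinkedGraph} (hX : ∃ f : Fin 3 → Fin (X.size + 1),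
    Function.Injective f ∧ ∀ i, IsBranch X.graph (f i)) (n₁ n₂ : ℕ) :
    ¬ IsDumbbell (unitGraphWith X n₁ n₂) := by
  intro h
  obtain ⟨f, hf, hb⟩ := hX
  have := h.card_le_two (fun i => linkCopy (units X n₁ n₂) (.inr 0) (f i))
    ((linkCopy_injective _ _).comp hf)
    fun i => IsBranch.linkCopy (units X n₁ n₂) (i := .inr 0) (hb i)
  simp at this

theorem not_isDumbbell_of_four_adj {X : LinkedGraph}
    (hX : ∃ (x : Fin (X.size + 1)) (f : Fin 4 → Fin (X.size + 1)),
      Function.Injective f ∧ ∀ i, X.graph.Adj x (f i)) (n₁ n₂ : ℕ) :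
    ¬ IsDumbbell (unitGraphWith X n₁ n₂) := by
  intro h
  obtain ⟨x, f, hf, hx⟩ := hX
  exact h.not_four_adj (x := linkCopy (units X n₁ n₂) (.inr 0) x)
    (fun i => linkCopy (units X n₁ n₂) (.inr 0) (f i)) ((linkCopy_injective _ _).comp hf)
    fun i => amalgam_adj_linkCopy (units X n₁ n₂) (i := .inr 0) (hx i)

theorem memGb_iff {V : Type*} (G : SimpleGraph V) : MemGb G ↔ IsDumbbellIn
    [(3, 3, 3), (3, 4, 2), (4, 4, 1), (3, 5, 1), (4, 5, 0), (3, 6, 2), (4, 6, 1)] G := by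
  constructor
  · have trans : ∀ {W : Type} {H : SimpleGraph W} {n₁ n₂ l : ℕ}, (n₁, n₂, l) ∈
        [(3, 3, 3), (3, 4, 2), (4, 4, 1), (3, 5, 1), (4, 5, 0), (3, 6, 2), (4, 6, 1)] →
        (G ≃g H) → Nonempty (H ≃g dumbbell n₁ n₂ l) → IsDumbbellIn
        [(3, 3, 3), (3, 4, 2), (4, 4, 1), (3, 5, 1), (4, 5, 0), (3, 6, 2), (4, 6, 1)] G :=
      fun hp e ⟨e'⟩ => ⟨_, hp, ⟨e.trans e'⟩⟩
    rintro ⟨⟨n₁, n₂, hn, ⟨e⟩⟩ | ⟨X, hX, n₁, n₂, hn, ⟨e⟩⟩, hG⟩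
    · have hG := hG.congr e
      have := card_unitGraph_le hG
      obtain ⟨rfl, rfl⟩ | ⟨rfl, rfl⟩ | ⟨rfl, rfl⟩ :
          n₁ = 2 ∧ n₂ = 0 ∨ n₁ = 1 ∧ n₂ = 1 ∨ n₁ = 0 ∧ n₂ = 2 := by omega
      · exact trans (by decide) e nonempty_unitGraph_two_zero
      · exact trans (by decide) e nonempty_unitGraph_one_one
      · exact trans (by decide) e nonempty_unitGraph_zero_two
    · have hG := hG.congr e
      simp only [List.mem_cons, List.not_mem_nil, or_false] at hX
      rcases hX with rfl | rfl | rfl | rfl | rfl | rfl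
      · have := card_unitGraphWith_X₁_le (by omega) hG
        obtain ⟨rfl, rfl⟩ | ⟨rfl, rfl⟩ : n₁ = 1 ∧ n₂ = 0 ∨ n₁ = 0 ∧ n₂ = 1 := by omega
        · exact trans (by decide) e nonempty_unitGraphWith_X₁_one_zero
        · exact trans (by decide) e nonempty_unitGraphWith_X₁_zero_one
      · have := card_unitGraphWith_X₂_le hG
        obtain ⟨rfl, rfl⟩ | ⟨rfl, rfl⟩ : n₁ = 1 ∧ n₂ = 0 ∨ n₁ = 0 ∧ n₂ = 1 := by omega
        · exact trans (by decide) e nonempty_unitGraphWith_X₂_one_zero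
        · exact trans (by decide) e nonempty_unitGraphWith_X₂_zero_one
      · exact absurd hG (not_isDumbbell_of_three_branch X₃_branch _ _)
      · exact absurd hG (not_isDumbbell_of_four_adj X₄_four_adj _ _)
      · exact absurd hG (not_isDumbbell_of_three_branch X₅_branch _ _)
      · exact absurd hG (not_isDumbbell_of_four_adj X₆_four_adj _ _)
  · rintro ⟨p, hp, ⟨e⟩⟩
    have h3 : 3 ≤ p.1 ∧ 3 ≤ p.2.1 := by
      clear e
      revert p
      decide
    refine ⟨?_, p.1, p.2.1, p.2.2, h3.1, h3.2, ⟨e⟩⟩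
    simp only [List.mem_cons, List.not_mem_nil, or_false] at hp
    rcases hp with rfl | rfl | rfl | rfl | rfl | rfl | rfl
    · exact .inl ⟨2, 0, by decide, nonempty_unitGraph_two_zero.map fun d => e.trans d.symm⟩
    · exact .inl ⟨1, 1, by decide, nonempty_unitGraph_one_one.map fun d => e.trans d.symm⟩
    · exact .inl ⟨0, 2, by decide, nonempty_unitGraph_zero_two.map fun d => e.trans d.symm⟩
    · exact .inr ⟨X₁, by simp, 1, 0, by decide,
        nonempty_unitGraphWith_X₁_one_zero.map fun d => e.trans d.symm⟩
    · exact .inr ⟨X₁, by simp, 0, 1, by decide,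
        nonempty_unitGraphWith_X₁_zero_one.map fun d => e.trans d.symm⟩
    · exact .inr ⟨X₂, by simp, 1, 0, by decide,
        nonempty_unitGraphWith_X₂_one_zero.map fun d => e.trans d.symm⟩
    · exact .inr ⟨X₂, by simp, 0, 1, by decide,
        nonempty_unitGraphWith_X₂_zero_one.map fun d => e.trans d.symm⟩

/-! ### The main result -/

theorem memDb_or_memGb_iff {V : Type*} (G : SimpleGraph V) :
    MemDb G ∨ MemGb G ↔ IsDumbbellIn exceptional G := by
  rw [memGb_iff, MemDb, IsDumbbellIn, IsDumbbellIn, IsDumbbellIn, ← exists_or]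
  refine exists_congr fun p => ?_
  rw [← or_and_right, ← List.mem_append]
  -- The list `exceptional` is the list of `𝓓_b` followed by that of `𝓖_b`, in this order.
  rfl

theorem card_eq_of_iso {V : Type*} [Fintype V] {G : SimpleGraph V} {n₁ n₂ l : ℕ}
    (e : G ≃g dumbbell n₁ n₂ l) : Fintype.card V = n₁ + n₂ + l := by
  rw [Fintype.card_congr e.toEquiv]
  simp only [Fintype.card_sum, Fintype.card_fin]
  omega

theorem IsDumbbell.exists_le {V : Type*} {G : SimpleGraph V} (hG : IsDumbbell G) :
    ∃ n₁ n₂ l, 3 ≤ n₁ ∧ n₁ ≤ n₂ ∧ Nonempty (G ≃g dumbbell n₁ n₂ l) := by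
  obtain ⟨n₁, n₂, l, h₁, h₂, ⟨e⟩⟩ := hG
  rcases le_total n₁ n₂ with h | h
  · exact ⟨n₁, n₂, l, h₁, h, ⟨e⟩⟩
  · exact ⟨n₂, n₁, l, h₂, h, (dumbbell_swap n₁ n₂ l).map e.trans⟩

theorem IsDumbbellIn.dtdNumber_bounds {V : Type*} [Fintype V] {G : SimpleGraph V}
    (hG : IsDumbbellIn exceptional G) :
    2 * dtdNumber G ≤ Fintype.card V ∧ Fintype.card V ≤ 2 * dtdNumber G + 1 := by
  obtain ⟨p, hp, ⟨e⟩⟩ := hG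
  rw [dtdNumber_congr e, card_eq_of_iso e]
  exact dtdNumber_exceptional hp

theorem IsDumbbell.dtdNumber_le {V : Type*} [Fintype V] {G : SimpleGraph V} (hG : IsDumbbell G)
    (hex : ¬ IsDumbbellIn exceptional G) : 2 * dtdNumber G + 2 ≤ Fintype.card V := by
  obtain ⟨n₁, n₂, l, h₁, hle, ⟨e⟩⟩ := hG.exists_le
  rw [dtdNumber_congr e, card_eq_of_iso e]
  exact two_mul_dtdNumber_add_two_le h₁ hle fun hp => hex ⟨_, hp, ⟨e⟩⟩

end DTDom

theorem mainTheorem5 {V : Type*} [Fintype V] (G : SimpleGraph V) :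
    (DTDom.IsDumbbell G →
      (DTDom.dtdNumber G : ℝ) ≤ (Fintype.card V : ℝ) / 2 ∧
      (((Fintype.card V : ℝ) - 1) / 2 ≤ (DTDom.dtdNumber G : ℝ) ↔
        DTDom.MemDb G ∨ DTDom.MemGb G)) ∧
    (DTDom.MemGb G ↔
      DTDom.IsDumbbellIn
        [(3, 3, 3), (3, 4, 2), (4, 4, 1), (3, 5, 1), (4, 5, 0), (3, 6, 2), (4, 6, 1)] G) := by
  refine ⟨fun hG => ?_, DTDom.memGb_iff G⟩
  rw [DTDom.memDb_or_memGb_iff]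
  by_cases hex : DTDom.IsDumbbellIn DTDom.exceptional G
  · obtain ⟨hu, hl⟩ := hex.dtdNumber_bounds
    have hu' : (2 : ℝ) * DTDom.dtdNumber G ≤ Fintype.card V := by exact_mod_cast hu
    have hl' : (Fintype.card V : ℝ) ≤ 2 * DTDom.dtdNumber G + 1 := by exact_mod_cast hl
    refine ⟨by linarith, fun _ => hex, fun _ => by linarith⟩
  -- Slack 2 contradicts `(n - 1) / 2 ≤ γ`, so both sides of the equivalence are false.
  · have hu' : (2 : ℝ) * DTDom.dtdNumber G + 2 ≤ Fintype.card V := by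
      exact_mod_cast hG.dtdNumber_le hex
    refine ⟨by linarith, fun h => ?_, fun h => absurd h hex⟩
    linarith
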